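/- Let $N\ge 3$ be an integer, $0\le s<2$ and $2^*(s)=\frac{2(N-s)}{N-2}$. Write points of $\mathbb{R}^N$ as $(x,y)$ with $x\in\mathbb{R}^{N-1}$, $y\in\mathbb{R}$, and let $\mathbb{R}^N_+=\{(x,y): y>0\}$ and $e_N=(0,1)$. Let $\dot W^{1,2}_0(\mathbb{R}^N_+)$ be the completion of $C_c^\infty(\mathbb{R}^N_+)$ with respect to the norm $\|\nabla(\cdot)\|_{L^2(\mathbb{R}^N_+)}$, realised as a space of (classes of) functions on $\mathbb{R}^N_+$. Let $$G_{\mathbb{R}^N_+,e_N}(x,y)=\frac{1}{(N-2)\,\omega_{N-1}}\left[\left(|x|^2+(1-y)^2\right)^{-\frac{N-2}{2}}-\left(|x|^2+(1+y)^2\right)^{-\frac{N-2}{2}}\right]$$ be the Green function of $-\Delta$ on $\mathbb{R}^N_+$ with pole $e_N$, where $\omega_{N-1}$ is the area of the unit sphere in $\mathbb{R}^N$. For $(x,y)\in\mathbb{R}^N_+$ put $$X=\frac{|x|^2+(1-y)^2}{|x|^2+(1+y)^2},\qquad V_2(x,y)=\frac{1+X^{N-1}-2X^{\frac{N-2}{2}}\,\frac{|x|^2+y^2-1}{|x|^2+(1+y)^2}}{\left[1-X^{\frac{N-2}{2}}\right]^2},$$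 and let $$S_{N,2,s}=\inf_{\varphi\in C_c^\infty(\mathbb{R}^N)\setminus\{0\}}\frac{\int_{\mathbb{R}^N}|\nabla\varphi|^2\,dz}{\left(\int_{\mathbb{R}^N}\frac{|\varphi|^{2^*(s)}}{|z|^s}\,dz\right)^{\frac{2}{2^*(s)}}}$$ be the Hardy–Sobolev best constant. Then for every $u\in\dot W^{1,2}_0(\mathbb{R}^N_+)$ of the form $u=\tilde u(G_{\mathbb{R}^N_+,e_N})$ almost everywhere, for some function $\tilde u$ on $[0,\infty)$, the integral on the left-hand side below is finite and $$S_{N,2,s}\left(\int_{\mathbb{R}^N_+}\frac{|u(x,y)|^{2^*(s)}}{\left(|x|^2+(1-y)^2\right)^{\frac{s}{2}}}\;\frac{V_2(x,y)}{\left[1-X^{\frac{N-2}{2}}\right]^{\frac{2-s}{N-2}}}\,dx\,dy\right)^{\frac{2}{2^*(s)}}\le\int_{\mathbb{R}^N_+}|\nabla u(x,y)|^2\,dx\,dy .$$ -/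

import Mathlib

open MeasureTheory Filter Topology
open scoped ContDiff

namespace HalfSpaceHS

/-- Euclidean space of dimension `N`; a point `z` is read as `(x, y)` with `y` its last coordinate. -/
abbrev E (N : ℕ) : Type := EuclideanSpace ℝ (Fin N)

/-- The index of the last coordinate. -/
def lastIdx (N : ℕ) [NeZero N] : Fin N := ⟨N - 1, Nat.sub_lt (NeZero.pos N) Nat.one_pos⟩

/-- The open upper half-space: the points `(x, y)` with `y > 0`. -/
def halfSpace (N : ℕ) [NeZero N] : Set (E N) := {z | 0 < z (lastIdx N)}

/-- The point `(0, 1)`. For `z = (x, y)` one has `‖z - eN N‖ ^ 2 = |x| ^ 2 + (1 - y) ^ 2` and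
`‖z + eN N‖ ^ 2 = |x| ^ 2 + (1 + y) ^ 2`. -/
noncomputable def eN (N : ℕ) [NeZero N] : E N := EuclideanSpace.single (lastIdx N) 1

/-- Smooth functions with compact support contained in `Ω`. -/
def IsTest {N : ℕ} (Ω : Set (E N)) (φ : E N → ℝ) : Prop :=
  ContDiff ℝ ∞ φ ∧ HasCompactSupport φ ∧ tsupport φ ⊆ Ω

/-- `g` is the weak (distributional) gradient of `u` on `Ω`. -/
def IsWeakGradient {N : ℕ} (Ω : Set (E N)) (u : E N → ℝ) (g : E N → E N) : Prop :=
  LocallyIntegrableOn u Ω ∧ LocallyIntegrableOn g Ω ∧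
    ∀ φ : E N → ℝ, IsTest Ω φ →
      ∫ z in Ω, u z • gradient φ z = - ∫ z in Ω, φ z • g z

/-- `u` belongs to the completion of the test functions on `Ω` for the norm `‖∇ ·‖_{L^p(Ω)}`,
realised as a space of functions: `u` is the local `L¹` limit of a sequence of test functions
whose gradients converge in `L^p(Ω)` to the weak gradient of `u`. -/
def MemHomSobolevZero {N : ℕ} (p : ENNReal) (Ω : Set (E N)) (u : E N → ℝ) : Prop :=
  ∃ (g : E N → E N) (φ : ℕ → E N → ℝ),
    IsWeakGradient Ω u g ∧ (∀ n, IsTest Ω (φ n)) ∧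
    (∀ K : Set (E N), IsCompact K → K ⊆ Ω →
      Tendsto (fun n => ∫⁻ z in K, ‖φ n z - u z‖ₑ) atTop (𝓝 0)) ∧
    Tendsto (fun n => eLpNorm (fun z => gradient (φ n) z - g z) p (volume.restrict Ω))
      atTop (𝓝 0)

/-- The area of the unit sphere in `E N`. -/
noncomputable def sphereArea (N : ℕ) : ℝ :=
  ((volume : Measure (E N)).toSphere Set.univ).toReal

/-- The Green function of `-Δ` on the half-space with pole `(0, 1)` (for `N > 2`). -/
noncomputable def green (N : ℕ) [NeZero N] (z : E N) : ℝ :=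
  1 / (((N : ℝ) - 2) * sphereArea N) *
    (‖z - eN N‖ ^ (-((N : ℝ) - 2)) - ‖z + eN N‖ ^ (-((N : ℝ) - 2)))

/-- `X = (|x|² + (1 - y)²) / (|x|² + (1 + y)²)`. -/
noncomputable def X (N : ℕ) [NeZero N] (z : E N) : ℝ := ‖z - eN N‖ ^ 2 / ‖z + eN N‖ ^ 2

/-- `V₂ = [1 + X^{N-1} - 2 X^{(N-2)/2} (|x|² + y² - 1) / (|x|² + (1 + y)²)] /
[1 - X^{(N-2)/2}]²`. -/
noncomputable def V2 (N : ℕ) [NeZero N] (z : E N) : ℝ :=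
  (1 + X N z ^ ((N : ℝ) - 1)
      - 2 * X N z ^ (((N : ℝ) - 2) / 2) * (‖z‖ ^ 2 - 1) / ‖z + eN N‖ ^ 2) /
    (1 - X N z ^ (((N : ℝ) - 2) / 2)) ^ 2

/-- The critical exponent `2*(s) = 2 (N - s) / (N - 2)`. -/
noncomputable def critExp (N : ℕ) (s : ℝ) : ℝ := 2 * ((N : ℝ) - s) / ((N : ℝ) - 2)

/-- The Hardy-Sobolev best constant `S_{N,2,s}` on the whole space. -/
noncomputable def hardySobolevConst (N : ℕ) (s : ℝ) : ℝ :=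
  sInf {c : ℝ | ∃ φ : E N → ℝ, IsTest Set.univ φ ∧ φ ≠ 0 ∧
    c = (∫ z, ‖gradient φ z‖ ^ 2) /
      (∫ z, |φ z| ^ critExp N s / ‖z‖ ^ s) ^ (2 / critExp N s)}

/-- The integrand on the left-hand side:
`|u|^{2*(s)} / (|x|² + (1 - y)²)^{s/2} * V₂ / [1 - X^{(N-2)/2}]^{(2-s)/(N-2)}`. -/
noncomputable def hsIntegrand (N : ℕ) [NeZero N] (s : ℝ) (u : E N → ℝ) (z : E N) : ℝ :=
  |u z| ^ critExp N s / ‖z - eN N‖ ^ s *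
    (V2 N z / (1 - X N z ^ (((N : ℝ) - 2) / 2)) ^ ((2 - s) / ((N : ℝ) - 2)))

end HalfSpaceHS

namespace HalfSpaceHS

/-! Let `Γ` be the Green function without its normalising factor: `|z|^(2-N)` on the whole space
with pole `0`, and the difference of two such kernels on the half-space with pole `(0,1)`. In both
cases `-ΔΓ = κ δ` with the same `κ = (N-2) ω_{N-1}`, and Green's identity shows that `Γ` pushes
`|∇Γ|² dz` forward to `κ dt` on `(0,∞)` (`IsGreen.map_energy`). For `u = w(Γ)` the Dirichlet energy
is therefore `κ ∫ w'²`. With `p = 2*(s)`, the integral of `|u|^p |∇Γ|² Γ^(-(p/2+1))` is `κ ∫ |w|^p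
t^(-(p/2+1))`.

Up to the factor `(N-2)²`, the weight `|∇Γ|² Γ^(-(p/2+1))` is `|z|^(-s)` on the whole space and the
weight of the theorem on the half-space (`hsIntegrand_eq`). Hence the Hardy–Sobolev inequality for
radial functions and the claimed inequality are the same inequality in the variable `t`
(`profile_hardySobolev`).

The remaining work is regularity: `u` has only a weak gradient, and its profile is an arbitrary
function. `IsGreen.exists_profile` averages the component of the gradient along `∇Γ` over level
sets, by the adjoint of composition with `Γ`. This produces `f ∈ L²(0,∞)` with `u = ∫_0^Γ f` almost
everywhere and `κ ∫ f² ≤ ∫ |∇u|²`. Density of derivatives of compactly supported profiles and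
Fatou's lemma (`lintegral_weight_le_of_profile`) carry one-dimensional inequalities over to `∫_0^t
f`. Finiteness comes from a separate, non-sharp bound (`IsProfile.weighted_le`), so positivity of
the best constant is never needed. -/

/-! ### Measurability of `v` deduced from measurability of `v ∘ Γ`. -/

/-- Images of Borel sets need not be Borel, but images of compact sets under a continuous map are
compact. Inner regularity exhausts `P`, up to a null set, by compact subsets of `U`, where `Γ` is
continuous. -/
lemma exists_measurable_image_subset {N : ℕ} {m : Measure (E N)} [IsFiniteMeasure m] {U : Set (E N)}
    (hU : MeasurableSet U) (hUm : m Uᶜ = 0) {Γ : E N → ℝ} (hΓ : ContinuousOn Γ U)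
    {P : Set (E N)} (hP : NullMeasurableSet P m) :
    ∃ C : Set ℝ, MeasurableSet C ∧ C ⊆ Γ '' P ∧ m (P \ Γ ⁻¹' C) = 0 := by
  obtain ⟨B, hBP, hB, hBe⟩ := hP.exists_measurable_subset_ae_eq
  have hK : ∀ n : ℕ, ∃ K ⊆ B ∩ U, IsCompact K ∧ m ((B ∩ U) \ K) < ((n : ENNReal) + 1)⁻¹ := by
    intro n
    exact (hB.inter hU).exists_isCompact_sdiff_lt (measure_ne_top _ _) (by simp)
  choose K hKB hKc hKm using hK
  refine ⟨⋃ n, Γ '' K n, ?_, ?_, ?_⟩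
  · refine MeasurableSet.iUnion fun n => ?_
    exact ((hKc n).image_of_continuousOn (hΓ.mono ((hKB n).trans Set.inter_subset_right))).measurableSet
  · exact Set.iUnion_subset fun n => Set.image_mono (((hKB n).trans Set.inter_subset_left).trans hBP)
  · have h1 : m ((B ∩ U) \ ⋃ n, K n) = 0 := by
      refine le_antisymm (ENNReal.le_of_forall_pos_le_add fun ε hε _ => ?_) (zero_le)
      obtain ⟨n, hn⟩ := ENNReal.exists_inv_nat_lt (a := (ε : ENNReal)) (by simpa using hε.ne')
      rw [zero_add]
      refine (measure_mono (Set.sdiff_subset_sdiff_right (Set.subset_iUnion K n))).trans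
        ((hKm n).le.trans (le_trans ?_ hn.le))
      exact ENNReal.inv_le_inv.2 le_self_add
    have h2 : m (P \ B) = 0 := (ae_le_set.1 hBe.symm.le)
    refine measure_mono_null (t := (P \ B) ∪ ((B ∩ U) \ ⋃ n, K n) ∪ Uᶜ) ?_ (by simp [h1, h2, hUm])
    rintro x ⟨hxP, hx⟩
    by_cases hxU : x ∈ U
    · by_cases hxB : x ∈ B
      · refine Or.inl (Or.inr ⟨⟨hxB, hxU⟩, fun h => hx ?_⟩)
        obtain ⟨n, hn⟩ := Set.mem_iUnion.1 h
        exact Set.mem_iUnion.2 ⟨n, x, hn, rfl⟩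
      · exact Or.inl (Or.inl ⟨hxP, hxB⟩)
    · exact Or.inr hxU

/-- If `v ∘ Γ` is a.e. measurable, so is `v` for the image measure, without any a priori
measurability of `v`. -/
lemma aemeasurable_of_comp {N : ℕ} {μ : Measure (E N)} [SigmaFinite μ] {U : Set (E N)}
    (hU : MeasurableSet U) (hUm : μ Uᶜ = 0) {Γ : E N → ℝ} (hΓ : ContinuousOn Γ U)
    {v : ℝ → ℝ} (hv : AEMeasurable (v ∘ Γ) μ) : AEMeasurable v (μ.map Γ) := by
  -- Only null sets matter, so `μ` is replaced by an equivalent finite measure, for which inner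
  -- regularity by compact sets is available.
  have hac : μ ≪ μ.toFinite := absolutelyContinuous_toFinite μ
  have hca : μ.toFinite ≪ μ := toFinite_absolutelyContinuous μ
  have hUm' : μ.toFinite Uᶜ = 0 := hca hUm
  have hΓm : AEMeasurable Γ μ := by
    have := hΓ.aemeasurable (μ := μ) hU
    rwa [Measure.restrict_eq_self_of_ae_mem (by rwa [ae_iff])] at this
  refine NullMeasurable.aemeasurable fun B hB => ?_
  have hv' : NullMeasurable (v ∘ Γ) μ.toFinite := (hv.mono_ac hca).nullMeasurable
  -- `C` lies inside `v ⁻¹' B`, `D` lies in its complement, and together they carry the whole image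
  -- measure; so `v ⁻¹' B` equals the Borel set `C` up to a null set.
  obtain ⟨C, hC, hCs, hC0⟩ := exists_measurable_image_subset hU hUm' hΓ (hv' hB)
  obtain ⟨D, hD, hDs, hD0⟩ := exists_measurable_image_subset hU hUm' hΓ (hv' hB.compl)
  have hCB : C ⊆ v ⁻¹' B := by
    intro t ht
    obtain ⟨x, hx, rfl⟩ := hCs ht
    exact hx
  have hDB : D ⊆ (v ⁻¹' B)ᶜ := by
    intro t ht
    obtain ⟨x, hx, rfl⟩ := hDs ht
    exact hx
  refine NullMeasurableSet.congr hC.nullMeasurableSet (s := C) ?_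
  refine (ae_eq_set.2 ⟨by simp [Set.sdiff_eq_empty.2 hCB], ?_⟩)
  refine measure_mono_null (t := (C ∪ D)ᶜ) ?_ ?_
  · rintro t ⟨h1, h2⟩ (h | h)
    · exact h2 h
    · exact hDB h h1
  · rw [Measure.map_apply_of_aemeasurable hΓm (hC.union hD).compl]
    refine hac (measure_mono_null (t := ((v ∘ Γ) ⁻¹' B \ Γ ⁻¹' C) ∪ ((v ∘ Γ) ⁻¹' Bᶜ \ Γ ⁻¹' D)) ?_
      (by rw [measure_union_null_iff]; exact ⟨hC0, hD0⟩))
    intro x hx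
    simp only [Set.preimage_compl, Set.preimage_union, Set.mem_compl_iff, Set.mem_union,
      not_or] at hx
    by_cases hxB : v (Γ x) ∈ B
    · exact Or.inl ⟨hxB, hx.1⟩
    · exact Or.inr ⟨hxB, hx.2⟩

/-! ### The divergence of `z / |z|^N` in polar coordinates. -/

/-- The vector field `z / |z|^N` has distributional divergence `|S^{N-1}| δ₀`. -/
lemma integral_inner_gradient_newton {N : ℕ} (hN : 0 < N) {ψ : E N → ℝ} (hψ : ContDiff ℝ 1 ψ)
    (hc : HasCompactSupport ψ)
    (hi : Integrable fun z : E N => inner ℝ (gradient ψ z) ((‖z‖ ^ N)⁻¹ • z)) :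
    ∫ z : E N, inner ℝ (gradient ψ z) ((‖z‖ ^ N)⁻¹ • z) = - (sphereArea N * ψ 0) := by
  have : Nonempty (Fin N) := ⟨⟨0, hN⟩⟩
  set F : E N → ℝ := fun z => inner ℝ (gradient ψ z) ((‖z‖ ^ N)⁻¹ • z) with hF
  have hdim : Module.finrank ℝ (E N) - 1 = N - 1 := by simp
  have hmp := (volume : Measure (E N)).measurePreserving_homeomorphUnitSphereProd
  set e := homeomorphUnitSphereProd (E N)
  have hi' : Integrable (fun p => F (e.symm p))
      ((volume : Measure (E N)).toSphere.prod (Measure.volumeIoiPow (Module.finrank ℝ (E N) - 1))) := by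
    rw [← hmp.integrable_comp_emb e.measurableEmbedding]
    have : (fun p => F (e.symm p)) ∘ e = F ∘ Subtype.val := by ext x; simp
    rw [this]
    exact (integrableOn_iff_comap_subtypeVal (measurableSet_singleton _).compl).1 hi.integrableOn
  have h1 : ∫ z, F z = ∫ p, F (e.symm p) ∂((volume : Measure (E N)).toSphere.prod
      (Measure.volumeIoiPow (Module.finrank ℝ (E N) - 1))) := by
    rw [← hmp.integral_comp e.measurableEmbedding]
    simp only [Homeomorph.symm_apply_apply]
    rw [integral_subtype_comap (measurableSet_singleton _).compl F,
      restrict_compl_singleton]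
  rw [h1, integral_prod _ hi']
  -- Along a ray the Jacobian `r^(N-1)` cancels `|z|^(-N) z`, leaving the integral over `(0,∞)` of
  -- the derivative of `r ↦ ψ(rθ)`.
  have h2 : ∀ θ : Metric.sphere (0 : E N) 1,
      ∫ r, F (e.symm (θ, r)) ∂(Measure.volumeIoiPow (Module.finrank ℝ (E N) - 1)) = - ψ 0 := by
    intro θ
    have hθ : ‖(θ : E N)‖ = 1 := by simp
    have hd : ∀ r : ℝ, HasDerivAt (fun r : ℝ => ψ (r • (θ : E N)))
        (inner ℝ (gradient ψ (r • (θ : E N))) (θ : E N)) r := by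
      intro r
      have h3 := ((hψ.differentiable one_ne_zero) (r • (θ : E N))).hasFDerivAt
      have h4 : HasDerivAt (fun r : ℝ => r • (θ : E N)) (θ : E N) r := by
        simpa using (hasDerivAt_id r).smul_const (θ : E N)
      rw [inner_gradient_left]
      exact h3.comp_hasDerivAt r h4
    have hcs : HasCompactSupport (fun r : ℝ => ψ (r • (θ : E N))) := by
      have : Topology.IsClosedEmbedding (fun r : ℝ => r • (θ : E N)) := by
        refine (AntilipschitzWith.isClosedEmbedding (K := 1) ?_ ?_)
        · refine AntilipschitzWith.of_le_mul_dist fun x y => ?_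
          rw [dist_eq_norm (x • _), ← sub_smul, norm_smul, hθ, Real.dist_eq]; simp
        · exact LipschitzWith.uniformContinuous (K := 1) (LipschitzWith.of_dist_le_mul fun x y => by
            rw [dist_eq_norm (x • _), ← sub_smul, norm_smul, hθ, Real.dist_eq]; simp)
      exact hc.comp_isClosedEmbedding this
    have hcont : Continuous (fun r : ℝ => inner ℝ (gradient ψ (r • (θ : E N))) (θ : E N)) := by
      have : Continuous (gradient ψ) := by
        unfold gradient
        exact (LinearIsometryEquiv.continuous _).comp (hψ.continuous_fderiv one_ne_zero)
      fun_prop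
    have hder : (fun r : ℝ => inner ℝ (gradient ψ (r • (θ : E N))) (θ : E N))
        = deriv (fun r : ℝ => ψ (r • (θ : E N))) := by
      ext r; exact (hd r).deriv.symm
    have hint : Integrable (fun r : ℝ => inner ℝ (gradient ψ (r • (θ : E N))) (θ : E N)) := by
      refine hcont.integrable_of_hasCompactSupport ?_
      rw [hder]
      exact hcs.deriv
    have h5 : ∫ r in Set.Ioi (0:ℝ), inner ℝ (gradient ψ (r • (θ : E N))) (θ : E N) = - ψ 0 := by
      have := integral_Ioi_of_hasDerivAt_of_tendsto' (a := 0) (m := 0)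
        (fun r _ => hd r) hint.integrableOn ?_
      · simpa using this
      · have h6 := hcs.is_zero_at_infty
        exact h6.mono_left atTop_le_cocompact
    rw [hdim, Measure.volumeIoiPow, integral_withDensity_eq_integral_toReal_smul]
    · rw [← h5, ← integral_subtype_comap measurableSet_Ioi]
      refine integral_congr_ae (Eventually.of_forall fun r => ?_)
      have hr : (0:ℝ) < r := r.2
      have hx : ((e.symm (θ, r) : ({0}ᶜ : Set (E N))) : E N) = (r : ℝ) • (θ : E N) := by simp [e]
      have hpow : ((r : ℝ) ^ N)⁻¹ * (r : ℝ) * (r : ℝ) ^ (N - 1) = 1 := by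
        rw [mul_assoc, ← pow_succ', Nat.sub_add_cancel hN, inv_mul_cancel₀ (by positivity)]
      simp only [hF, hx, norm_smul, hθ, mul_one, Real.norm_eq_abs, abs_of_pos hr, inner_smul_right,
        smul_eq_mul, ENNReal.toReal_ofReal (pow_nonneg hr.le _)]
      linear_combination (inner ℝ (gradient ψ ((r : ℝ) • (θ : E N))) (θ : E N)) * hpow
    · fun_prop
    · simp
  simp_rw [h2]
  simp [sphereArea, Measure.real]

lemma integrable_smul_of_tsupport_subset {N : ℕ} {F : Type*} [NormedAddCommGroup F]
    [NormedSpace ℝ F] {U : Set (E N)} {η : E N → ℝ} (hη : Continuous η)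
    (hc : HasCompactSupport η) (hU : tsupport η ⊆ U) {f : E N → F} (hf : LocallyIntegrableOn f U) :
    Integrable (fun z => η z • f z) := by
  have h1 : IntegrableOn (fun z => η z • f z) (tsupport η) :=
    (hf.integrableOn_compact_subset hU hc).continuousOn_smul hη.continuousOn hc
  rwa [integrableOn_iff_integrable_of_support_subset] at h1
  intro z hz
  refine subset_tsupport η fun h => hz ?_
  simp [h]

/-! ### Abstract Green functions and compositions with them. -/

/-- `Γ` behaves like a multiple of the Green function of `-Δ` on `Ω` with pole `e`:
`-ΔΓ = κ δ_e`. -/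
structure IsGreen {N : ℕ} (Ω : Set (E N)) (e : E N) (Γ : E N → ℝ) (κ : ℝ) : Prop where
  isOpen : IsOpen Ω
  mem : e ∈ Ω
  const_pos : 0 < κ
  zero_off : ∀ z, z ∉ Ω → Γ z = 0
  zero_pole : Γ e = 0
  pos : ∀ z ∈ Ω \ {e}, 0 < Γ z
  smooth : ∀ z ∈ Ω \ {e}, ContDiffAt ℝ ∞ Γ z
  compact : ∀ a > 0, ∃ K, IsCompact K ∧ K ⊆ Ω ∧ {z | a ≤ Γ z} ⊆ K
  pole : Tendsto Γ (𝓝[≠] e) atTop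
  gradient_ne : ∀ z ∈ Ω \ {e}, gradient Γ z ≠ 0
  green : ∀ ψ : E N → ℝ, ContDiff ℝ 1 ψ → HasCompactSupport ψ → tsupport ψ ⊆ Ω →
    (∀ᶠ z in 𝓝 e, ψ z = ψ e) → ∫ z in Ω, inner ℝ (gradient ψ z) (gradient Γ z) = κ * ψ e

namespace IsGreen

variable {N : ℕ} {Ω : Set (E N)} {e : E N} {Γ : E N → ℝ} {κ : ℝ}

lemma isOpen_diff (hG : IsGreen Ω e Γ κ) : IsOpen (Ω \ {e}) := hG.isOpen.sdiff isClosed_singleton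

lemma continuousOn (hG : IsGreen Ω e Γ κ) : ContinuousOn Γ (Ω \ {e}) :=
  fun z hz => (hG.smooth z hz).continuousAt.continuousWithinAt

lemma continuousOn_gradient (hG : IsGreen Ω e Γ κ) : ContinuousOn (gradient Γ) (Ω \ {e}) := by
  intro z hz
  have h := ((hG.smooth z hz).fderiv_right (m := 0) (by simp)).continuousAt
  have : ContinuousAt (gradient Γ) z := by
    unfold gradient
    exact (LinearIsometryEquiv.continuous _).continuousAt.comp h
  exact this.continuousWithinAt

/-- A profile vanishing up to `a > 0` lives on a superlevel set of `Γ`, which is relatively compact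
in `Ω`. Since `Γ e = 0` by convention, `H ∘ Γ` has the wrong value at the pole; `Function.update`
replaces it by `C`, the value of `H` at infinity in the applications. -/
lemma exists_isCompact (hG : IsGreen Ω e Γ κ) {a : ℝ} (ha : 0 < a) {H : ℝ → ℝ} {C : ℝ}
    (h0 : ∀ t ≤ a, H t = 0) :
    HasCompactSupport (Function.update (H ∘ Γ) e C) ∧
      tsupport (Function.update (H ∘ Γ) e C) ⊆ Ω := by
  obtain ⟨K, hK, hKΩ, hKa⟩ := hG.compact a ha
  have hK' : IsCompact (insert e K) := hK.insert e
  have hs : Function.support (Function.update (H ∘ Γ) e C) ⊆ insert e K := by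
    intro z hz
    by_contra hzK
    simp only [Set.mem_insert_iff, not_or] at hzK
    refine hz ?_
    rw [Function.update_of_ne hzK.1]
    refine h0 _ (le_of_lt (not_le.1 fun h => hzK.2 (hKa h)))
  refine ⟨HasCompactSupport.of_support_subset_isCompact hK' hs, ?_⟩
  exact (closure_minimal hs hK'.isClosed).trans (Set.insert_subset hG.mem hKΩ)

lemma update_eventuallyEq (hG : IsGreen Ω e Γ κ) {b : ℝ} {H : ℝ → ℝ} {C : ℝ}
    (h1 : ∀ t, b ≤ t → H t = C) : ∀ᶠ z in 𝓝 e, Function.update (H ∘ Γ) e C z = C := by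
  have h := hG.pole.eventually_ge_atTop b
  rw [eventually_nhdsWithin_iff] at h
  filter_upwards [h] with z hz
  by_cases hze : z = e
  · simp [hze]
  · rw [Function.update_of_ne hze]; exact h1 _ (hz hze)

lemma contDiff_update (hG : IsGreen Ω e Γ κ) {a b : ℝ} (ha : 0 < a) {H : ℝ → ℝ} {C : ℝ}
    (h0 : ∀ t ≤ a, H t = 0) (h1 : ∀ t, b ≤ t → H t = C) {n : ℕ∞} (hH : ContDiff ℝ n H) :
    ContDiff ℝ n (Function.update (H ∘ Γ) e C) := by
  rw [contDiff_iff_contDiffAt]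
  intro z
  by_cases hze : z = e
  · subst hze
    exact contDiffAt_const.congr_of_eventuallyEq (hG.update_eventuallyEq h1)
  by_cases hz : z ∈ Ω
  · have h2 : Function.update (H ∘ Γ) e C =ᶠ[𝓝 z] H ∘ Γ := by
      filter_upwards [isOpen_ne.mem_nhds hze] with y hy using Function.update_of_ne hy _ _
    refine ContDiffAt.congr_of_eventuallyEq ?_ h2
    exact hH.contDiffAt.comp z ((hG.smooth z ⟨hz, hze⟩).of_le (by exact_mod_cast le_top))
  · have h3 : z ∉ tsupport (Function.update (H ∘ Γ) e C) :=
      fun h => hz ((hG.exists_isCompact ha h0).2 h)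
    exact contDiffAt_const.congr_of_eventuallyEq (notMem_tsupport_iff_eventuallyEq.1 h3)

lemma update_zero (hG : IsGreen Ω e Γ κ) {H : ℝ → ℝ} (h0 : H 0 = 0) :
    Function.update (H ∘ Γ) e 0 = H ∘ Γ := by
  rw [Function.update_eq_self_iff]
  simp [hG.zero_pole, h0]

lemma gradient_update (hG : IsGreen Ω e Γ κ) {H : ℝ → ℝ} {H' C : ℝ} {z : E N}
    (hz : z ∈ Ω \ {e}) (hH : HasDerivAt H H' (Γ z)) :
    gradient (Function.update (H ∘ Γ) e C) z = H' • gradient Γ z := by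
  have h2 : Function.update (H ∘ Γ) e C =ᶠ[𝓝 z] H ∘ Γ := by
    filter_upwards [isOpen_ne.mem_nhds hz.2] with y hy using Function.update_of_ne hy _ _
  rw [h2.gradient_eq]
  refine HasGradientAt.gradient ?_
  rw [hasGradientAt_iff_hasFDerivAt]
  have h3 := ((hG.smooth z hz).differentiableAt (by simp)).hasGradientAt.hasFDerivAt
  have h4 := hH.comp_hasFDerivAt z h3
  simpa using h4

/-- Composition with a profile supported in a compact subset of `(0, ∞)`. -/
lemma comp_props (hG : IsGreen Ω e Γ κ) {a b : ℝ} (ha : 0 < a) {h : ℝ → ℝ}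
    (h0 : ∀ t ≤ a, h t = 0) (h1 : ∀ t, b ≤ t → h t = 0) {n : ℕ∞} (hh : ContDiff ℝ n h) :
    ContDiff ℝ n (h ∘ Γ) ∧ HasCompactSupport (h ∘ Γ) ∧ tsupport (h ∘ Γ) ⊆ Ω \ {e} := by
  have hu := hG.update_zero (H := h) (h0 0 ha.le)
  have h2 := hG.contDiff_update ha h0 h1 hh
  have h3 := hG.exists_isCompact (C := 0) ha h0
  have h4 := hG.update_eventuallyEq h1
  rw [hu] at h2 h3 h4
  refine ⟨h2, h3.1, fun z hz => ⟨h3.2 hz, ?_⟩⟩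
  rintro rfl
  exact (notMem_tsupport_iff_eventuallyEq.2 h4) hz

lemma restrict_sdiff_singleton (h : 0 < N) :
    (volume : Measure (E N)).restrict (Ω \ {e}) = volume.restrict Ω := by
  have : Nonempty (Fin N) := ⟨⟨0, h⟩⟩
  refine Measure.restrict_congr_set (sdiff_null_ae_eq_self (by simp))

/-- The measure `|∇Γ|² dz` on `Ω`. -/
noncomputable def energy (Ω : Set (E N)) (e : E N) (Γ : E N → ℝ) : Measure (E N) :=
  (volume.restrict (Ω \ {e})).withDensity fun z => ENNReal.ofReal (‖gradient Γ z‖ ^ 2)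

lemma aemeasurable_density (hG : IsGreen Ω e Γ κ) :
    AEMeasurable (fun z => ENNReal.ofReal (‖gradient Γ z‖ ^ 2)) (volume.restrict (Ω \ {e})) :=
  (((hG.continuousOn_gradient.norm.pow 2).aemeasurable hG.isOpen_diff.measurableSet)).ennreal_ofReal

lemma integral_energy (hG : IsGreen Ω e Γ κ) (f : E N → ℝ) :
    ∫ z, f z ∂(energy Ω e Γ) = ∫ z in Ω \ {e}, ‖gradient Γ z‖ ^ 2 * f z := by
  rw [energy, integral_withDensity_eq_integral_toReal_smul₀ hG.aemeasurable_density (by simp)]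
  simp

lemma integrable_energy_iff (hG : IsGreen Ω e Γ κ) (f : E N → ℝ) :
    Integrable f (energy Ω e Γ) ↔ IntegrableOn (fun z => ‖gradient Γ z‖ ^ 2 * f z) (Ω \ {e}) := by
  rw [energy, integrable_withDensity_iff_integrable_smul₀' hG.aemeasurable_density (by simp)]
  simp [IntegrableOn]

lemma energy_ac : energy Ω e Γ ≪ volume.restrict (Ω \ {e}) := withDensity_absolutelyContinuous _ _

/-- The density `|∇Γ|²` is positive off the pole. Together with `energy_ac` this makes the energy
measure and Lebesgue measure on `Ω` have the same null sets. -/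
lemma ac_energy (hG : IsGreen Ω e Γ κ) : volume.restrict (Ω \ {e}) ≪ energy Ω e Γ := by
  refine withDensity_absolutelyContinuous' hG.aemeasurable_density ?_
  filter_upwards [ae_restrict_mem hG.isOpen_diff.measurableSet] with z hz
  simpa using hG.gradient_ne z hz

lemma aemeasurable (hG : IsGreen Ω e Γ κ) : AEMeasurable Γ (energy Ω e Γ) :=
  (hG.continuousOn.aemeasurable hG.isOpen_diff.measurableSet).mono_ac energy_ac

instance sigmaFinite_energy : SigmaFinite (energy Ω e Γ) :=
  SigmaFinite.withDensity_of_ne_top' (by simp)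

/-- This replaces the coarea formula. Green's identity is tested with `ψ = H(Γ)`, where `H` is the
primitive of `h`: then `∇ψ · ∇Γ = h(Γ) |∇Γ|²`, and `ψ` is equal to `∫ h` near the pole. -/
lemma integral_comp_continuous (hG : IsGreen Ω e Γ κ) (hN : 0 < N) {a b : ℝ} (ha : 0 < a)
    {h : ℝ → ℝ} (hh : Continuous h) (h0 : ∀ t ≤ a, h t = 0) (h1 : ∀ t, b ≤ t → h t = 0) :
    Integrable (fun z => h (Γ z)) (energy Ω e Γ) ∧
    ∫ z, h (Γ z) ∂(energy Ω e Γ) = κ * ∫ t, h t := by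
  have hp := hG.comp_props ha h0 h1 (n := 0) (contDiff_zero.2 hh)
  refine ⟨?_, ?_⟩
  · rw [hG.integrable_energy_iff]
    have hli : LocallyIntegrableOn (fun z => ‖gradient Γ z‖ ^ 2) (Ω \ {e}) :=
      (hG.continuousOn_gradient.norm.pow 2).locallyIntegrableOn hG.isOpen_diff.measurableSet
    have := integrable_smul_of_tsupport_subset hp.1.continuous hp.2.1 hp.2.2 hli
    simpa [mul_comm] using this.integrableOn
  · set H : ℝ → ℝ := fun t => ∫ s in (0:ℝ)..t, h s with hH
    have hd : ∀ t, HasDerivAt H (h t) t := fun t => hh.integral_hasStrictDerivAt 0 t |>.hasDerivAt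
    have hHc : ContDiff ℝ 1 H := by
      rw [contDiff_one_iff_deriv]
      refine ⟨fun t => (hd t).differentiableAt, ?_⟩
      rwa [show deriv H = h from funext fun t => (hd t).deriv]
    have hH0 : ∀ t ≤ a, H t = 0 := by
      intro t ht
      refine intervalIntegral.integral_zero_ae (f := h) (Eventually.of_forall fun x hx => h0 _ ?_)
      exact hx.2.trans (max_le ha.le ht)
    have hC : ∀ t, max a b ≤ t → H t = ∫ t, h t := by
      intro t ht
      have h2 : 0 ≤ t := ha.le.trans ((le_max_left _ _).trans ht)
      rw [hH]
      dsimp only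
      rw [intervalIntegral.integral_of_le h2, setIntegral_eq_integral_of_forall_compl_eq_zero]
      intro x hx
      simp only [Set.mem_Ioc, not_and_or, not_lt, not_le] at hx
      rcases hx with hx | hx
      · exact h0 _ (hx.trans ha.le)
      · exact h1 _ ((le_max_right a b).trans (ht.trans hx.le))
    have hgr := hG.green (Function.update (H ∘ Γ) e (∫ t, h t))
      (hG.contDiff_update (n := 1) ha hH0 hC hHc) (hG.exists_isCompact ha hH0).1
      (hG.exists_isCompact ha hH0).2 (by simpa using hG.update_eventuallyEq hC)
    rw [Function.update_self] at hgr
    rw [← hgr, hG.integral_energy, ← restrict_sdiff_singleton (Ω := Ω) (e := e) hN]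
    refine setIntegral_congr_fun hG.isOpen_diff.measurableSet fun z (hz : z ∈ Ω \ {e}) => ?_
    rw [hG.gradient_update hz (hd (Γ z)), inner_smul_left, real_inner_self_eq_norm_sq]
    simp [mul_comm]

lemma lintegral_comp_continuous (hG : IsGreen Ω e Γ κ) (hN : 0 < N) {a b : ℝ} (ha : 0 < a)
    {h : ℝ → ℝ} (hh : Continuous h) (h0 : ∀ t ≤ a, h t = 0) (h1 : ∀ t, b ≤ t → h t = 0)
    (hn : ∀ t, 0 ≤ h t) :
    ∫⁻ t, ENNReal.ofReal (h t) ∂((energy Ω e Γ).map Γ) =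
      ∫⁻ t, ENNReal.ofReal (h t) ∂(ENNReal.ofReal κ • volume.restrict (Set.Ioi (0:ℝ))) := by
  obtain ⟨hi, he⟩ := hG.integral_comp_continuous hN ha hh h0 h1
  have hhi : Integrable h := by
    refine hh.integrable_of_hasCompactSupport
      (HasCompactSupport.of_support_subset_isCompact (isCompact_Icc (a := a) (b := b)) fun t ht => ?_)
    refine ⟨le_of_lt (not_le.1 fun h' => ht (h0 _ h')), le_of_lt (not_le.1 fun h' => ht (h1 _ h'))⟩
  rw [lintegral_map' (by fun_prop) hG.aemeasurable,
    ← ofReal_integral_eq_lintegral_ofReal hi (Eventually.of_forall fun z => hn _), he,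
    lintegral_smul_measure, smul_eq_mul,
    ENNReal.ofReal_mul hG.const_pos.le,
    ← ofReal_integral_eq_lintegral_ofReal hhi.restrict (Eventually.of_forall fun z => hn _)]
  congr 2
  rw [setIntegral_eq_integral_of_forall_compl_eq_zero]
  intro x hx
  exact h0 _ ((not_lt.1 hx).trans ha.le)

end IsGreen

/-! ### The image of `|∇Γ|² dz` under `Γ`. -/

/-- A continuous tent converging monotonically to the indicator of `(a, b)`. -/
noncomputable def tent (a b : ℝ) (n : ℕ) (t : ℝ) : ℝ :=
  max 0 (min 1 (min (((n : ℝ) + 1) * (t - a) - 1) (((n : ℝ) + 1) * (b - t))))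

lemma continuous_tent (a b : ℝ) (n : ℕ) : Continuous (tent a b n) := by
  unfold tent; fun_prop

/-- The shift by `-1` in the left slope is there for the case `a = 0`: the tent still vanishes near
`0`, as `lintegral_comp_continuous` requires. -/
lemma tent_eq_zero_left {a b : ℝ} {n : ℕ} {t : ℝ} (h : t ≤ a + 1 / ((n : ℝ) + 1)) :
    tent a b n t = 0 := by
  refine max_eq_left ((min_le_right _ _).trans ((min_le_left _ _).trans ?_))
  have : ((n : ℝ) + 1) * (t - a) ≤ ((n : ℝ) + 1) * (1 / ((n : ℝ) + 1)) := by
    gcongr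
    linarith
  rw [mul_one_div_cancel (by positivity)] at this
  linarith

lemma tent_eq_zero_right {a b : ℝ} {n : ℕ} {t : ℝ} (h : b ≤ t) : tent a b n t = 0 := by
  refine max_eq_left ((min_le_right _ _).trans ((min_le_right _ _).trans ?_))
  exact mul_nonpos_of_nonneg_of_nonpos (by positivity) (by linarith)

lemma monotone_tent (a b t : ℝ) : Monotone fun n => tent a b n t := by
  intro m n hmn
  simp only
  rcases le_or_gt t a with h | h
  · rw [tent_eq_zero_left (h.trans (by simp; positivity)),
      tent_eq_zero_left (h.trans (by simp; positivity))]
  rcases le_or_gt b t with h' | h'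
  · rw [tent_eq_zero_right h', tent_eq_zero_right h']
  have hmn' : (m : ℝ) ≤ n := by exact_mod_cast hmn
  unfold tent
  gcongr

lemma tendsto_tent (a b t : ℝ) : Tendsto (fun n => ENNReal.ofReal (tent a b n t)) atTop
    (𝓝 ((Set.Ioo a b).indicator 1 t)) := by
  by_cases ht : t ∈ Set.Ioo a b
  · rw [Set.indicator_of_mem ht]
    have hlim : Tendsto (fun n : ℕ => (n : ℝ) + 1) atTop atTop :=
      tendsto_atTop_add_const_right _ _ tendsto_natCast_atTop_atTop
    refine tendsto_const_nhds.congr' ?_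
    filter_upwards [(hlim.atTop_mul_const (sub_pos.2 ht.1)).eventually_ge_atTop 2,
      (hlim.atTop_mul_const (sub_pos.2 ht.2)).eventually_ge_atTop 1] with n h1 h2
    have : tent a b n t = 1 := by
      unfold tent
      rw [min_eq_left (le_min (by linarith) h2), max_eq_right zero_le_one]
    simp [this]
  · rw [Set.indicator_of_notMem ht]
    refine tendsto_const_nhds.congr fun n => ?_
    simp only [Set.mem_Ioo, not_and_or, not_lt] at ht
    rcases ht with h | h
    · rw [tent_eq_zero_left (h.trans (by simp; positivity))]; simp
    · rw [tent_eq_zero_right h]; simp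

lemma tendsto_lintegral_tent (ν : Measure ℝ) (a b : ℝ) :
    Tendsto (fun n => ∫⁻ t, ENNReal.ofReal (tent a b n t) ∂ν) atTop (𝓝 (ν (Set.Ioo a b))) := by
  rw [← lintegral_indicator_one measurableSet_Ioo]
  refine lintegral_tendsto_of_tendsto_of_monotone
    (fun n => ((continuous_tent a b n).measurable.ennreal_ofReal).aemeasurable) ?_ ?_
  · exact Eventually.of_forall fun t m n hmn => ENNReal.ofReal_le_ofReal (monotone_tent a b t hmn)
  · exact Eventually.of_forall fun t => tendsto_tent a b t

namespace IsGreen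

variable {N : ℕ} {Ω : Set (E N)} {e : E N} {Γ : E N → ℝ} {κ : ℝ}

/-- The image of `|∇Γ|² dz` under `Γ` is a multiple of Lebesgue measure on `(0, ∞)`. -/
lemma map_energy (hG : IsGreen Ω e Γ κ) (hN : 0 < N) :
    (energy Ω e Γ).map Γ = ENNReal.ofReal κ • volume.restrict (Set.Ioi (0:ℝ)) := by
  have hloc : IsLocallyFiniteMeasure (ENNReal.ofReal κ • volume.restrict (Set.Ioi (0:ℝ))) :=
    inferInstanceAs (IsLocallyFiniteMeasure (κ.toNNReal • volume.restrict (Set.Ioi (0:ℝ))))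
  refine (Real.measure_ext_Ioo_rat fun p q => ?_).symm
  have key : ∀ a b : ℝ, 0 ≤ a → (energy Ω e Γ).map Γ (Set.Ioo a b) =
      (ENNReal.ofReal κ • volume.restrict (Set.Ioi (0:ℝ))) (Set.Ioo a b) := by
    intro a b ha
    refine tendsto_nhds_unique (tendsto_lintegral_tent _ a b) ?_
    refine (tendsto_lintegral_tent _ a b).congr fun n => ?_
    exact (hG.lintegral_comp_continuous hN (a := a + 1 / ((n : ℝ) + 1)) (b := b) (by positivity)
      (continuous_tent a b n) (fun t ht => tent_eq_zero_left ht)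
      (fun t ht => tent_eq_zero_right ht) (fun t => le_max_left _ _)).symm
  -- Both measures vanish off `(0,∞)`, so intervals with a negative left end may be cut at `0`.
  have hI : Set.Ioo (max (p:ℝ) 0) q = Set.Ioo (p:ℝ) q ∩ Set.Ioi 0 := by
    ext t; simp; tauto
  have h1 := key (max p 0) q (le_max_right _ _)
  have hz : (energy Ω e Γ).map Γ (Set.Ioi 0)ᶜ = 0 := by
    rw [Measure.map_apply_of_aemeasurable hG.aemeasurable measurableSet_Ioi.compl]
    refine energy_ac ?_
    rw [Set.preimage_compl]
    change Γ ⁻¹' Set.Ioi 0 ∈ ae _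
    filter_upwards [ae_restrict_mem hG.isOpen_diff.measurableSet] with z hz using hG.pos z hz
  have hz' : (ENNReal.ofReal κ • volume.restrict (Set.Ioi (0:ℝ))) (Set.Ioi 0)ᶜ = 0 := by
    rw [Measure.smul_apply, Measure.restrict_apply measurableSet_Ioi.compl, Set.compl_inter_self]
    simp
  rw [hI, measure_inter_conull hz, measure_inter_conull hz'] at h1
  exact h1.symm

end IsGreen

/-! ### Convergence in `L²` and uniqueness of weak gradients. -/

section L2

variable {α F : Type*} [MeasurableSpace α] {μ : Measure α} [NormedAddCommGroup F]
  [InnerProductSpace ℝ F]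

lemma inner_toLp {f g : α → F} (hf : MemLp f 2 μ) (hg : MemLp g 2 μ) :
    inner ℝ (hf.toLp f) (hg.toLp g) = ∫ x, inner ℝ (f x) (g x) ∂μ := by
  rw [L2.inner_def]
  refine integral_congr_ae ?_
  filter_upwards [hf.coeFn_toLp, hg.coeFn_toLp] with x h1 h2
  rw [h1, h2]

lemma integrable_inner_of_memLp {f g : α → F} (hf : MemLp f 2 μ) (hg : MemLp g 2 μ) :
    Integrable (fun x => inner ℝ (f x) (g x)) μ := by
  refine (L2.integrable_inner (𝕜 := ℝ) (hf.toLp f) (hg.toLp g)).congr ?_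
  filter_upwards [hf.coeFn_toLp, hg.coeFn_toLp] with x h1 h2
  rw [h1, h2]

lemma tendsto_integral_inner {f : ℕ → α → F} {f' g : α → F} (hf : ∀ n, MemLp (f n) 2 μ)
    (hf' : MemLp f' 2 μ) (hg : MemLp g 2 μ)
    (h : Tendsto (fun n => eLpNorm (fun x => f n x - f' x) 2 μ) atTop (𝓝 0)) :
    Tendsto (fun n => ∫ x, inner ℝ (f n x) (g x) ∂μ) atTop (𝓝 (∫ x, inner ℝ (f' x) (g x) ∂μ)) := by
  simp_rw [← inner_toLp (hf _) hg, ← inner_toLp hf' hg]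
  exact ((Lp.tendsto_Lp_iff_tendsto_eLpNorm'' f hf f' hf').2 h).inner tendsto_const_nhds

end L2

lemma continuous_gradient {N : ℕ} {φ : E N → ℝ} (h : ContDiff ℝ 1 φ) : Continuous (gradient φ) := by
  unfold gradient
  exact (LinearIsometryEquiv.continuous _).comp (h.continuous_fderiv one_ne_zero)

lemma tsupport_gradient_subset {N : ℕ} (φ : E N → ℝ) : tsupport (gradient φ) ⊆ tsupport φ := by
  refine closure_minimal (fun z hz => ?_) (isClosed_tsupport φ)
  by_contra h
  refine hz ?_
  rw [(notMem_tsupport_iff_eventuallyEq.1 h).gradient_eq]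
  exact gradient_fun_const z 0

lemma hasCompactSupport_gradient {N : ℕ} {φ : E N → ℝ} (h : HasCompactSupport φ) :
    HasCompactSupport (gradient φ) :=
  h.of_isClosed_subset (isClosed_tsupport _) (tsupport_gradient_subset φ)

lemma IsTest.memLp_gradient {N : ℕ} {Ω : Set (E N)} {φ : E N → ℝ} (h : IsTest Ω φ)
    (p : ENNReal) : MemLp (gradient φ) p volume :=
  (continuous_gradient (h.1.of_le (by simp))).memLp_of_hasCompactSupport
    (hasCompactSupport_gradient h.2.1)

/-- The gradient provided by membership in the Sobolev space and the one named in the theorem must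
be identified; their difference integrates to zero against all test functions. -/
lemma IsWeakGradient.ae_eq {N : ℕ} {Ω : Set (E N)} (hΩ : IsOpen Ω) {u : E N → ℝ}
    {g g' : E N → E N} (hg : IsWeakGradient Ω u g) (hg' : IsWeakGradient Ω u g') :
    g =ᵐ[volume.restrict Ω] g' := by
  have h := hΩ.ae_eq_zero_of_integral_contDiff_smul_eq_zero (hg.2.1.sub hg'.2.1)
    (fun φ h1 h2 h3 => ?_)
  · rw [EventuallyEq, ae_restrict_iff' hΩ.measurableSet]
    filter_upwards [h] with z hz hzΩ using sub_eq_zero.1 (hz hzΩ)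
  · have h4 : ∀ f : E N → E N, ∫ z in Ω, φ z • f z = ∫ z, φ z • f z := by
      intro f
      refine setIntegral_eq_integral_of_forall_compl_eq_zero fun z hz => ?_
      rw [image_eq_zero_of_notMem_tsupport (fun h => hz (h3 h)), zero_smul]
    have h5 := hg.2.2 φ ⟨h1, h2, h3⟩
    rw [hg'.2.2 φ ⟨h1, h2, h3⟩, h4, h4, neg_inj] at h5
    simp only [Pi.sub_apply, smul_sub]
    rw [integral_sub (integrable_smul_of_tsupport_subset h1.continuous h2 h3 hg.2.1)
      (integrable_smul_of_tsupport_subset h1.continuous h2 h3 hg'.2.1), h5, sub_self]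

lemma memLp_of_tendsto {N : ℕ} {Ω : Set (E N)} {p : ENNReal} {φ : ℕ → E N → ℝ}
    {g : E N → E N} (hg : AEStronglyMeasurable g (volume.restrict Ω)) (hφ : ∀ n, IsTest Ω (φ n))
    (h : Tendsto (fun n => eLpNorm (fun z => gradient (φ n) z - g z) p (volume.restrict Ω))
      atTop (𝓝 0)) : MemLp g p (volume.restrict Ω) := by
  obtain ⟨n, hn⟩ := (h.eventually_lt_const (show (0 : ENNReal) < 1 by simp)).exists
  have h1 : MemLp (gradient (φ n)) p (volume.restrict Ω) := ((hφ n).memLp_gradient p).restrict Ω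
  have h2 : MemLp (fun z => gradient (φ n) z - g z) p (volume.restrict Ω) :=
    ⟨h1.aestronglyMeasurable.sub hg, hn.trans ENNReal.one_lt_top⟩
  have := h1.sub h2
  simpa [Pi.sub_def] using this

lemma tendsto_integral_mul_of_lintegral {N : ℕ} {Ω : Set (E N)} {u : E N → ℝ} {φ : ℕ → E N → ℝ}
    (hφ : ∀ n, LocallyIntegrableOn (φ n) Ω) (hu : LocallyIntegrableOn u Ω)
    (h : ∀ K : Set (E N), IsCompact K → K ⊆ Ω →
      Tendsto (fun n => ∫⁻ z in K, ‖φ n z - u z‖ₑ) atTop (𝓝 0))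
    {η : E N → ℝ} (hη : Continuous η) (hc : HasCompactSupport η) (hs : tsupport η ⊆ Ω) :
    Tendsto (fun n => ∫ z, η z * φ n z) atTop (𝓝 (∫ z, η z * u z)) := by
  obtain ⟨M, hM⟩ := hc.exists_bound_of_continuous hη
  refine tendsto_integral_of_L1 _
    (integrable_smul_of_tsupport_subset hη hc hs hu).aestronglyMeasurable
    (Eventually.of_forall fun n => integrable_smul_of_tsupport_subset hη hc hs (hφ n)) ?_
  have h1 := ENNReal.Tendsto.const_mul (a := ENNReal.ofReal M) (h (tsupport η) hc hs)
    (Or.inr ENNReal.ofReal_ne_top)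
  rw [mul_zero] at h1
  refine tendsto_of_tendsto_of_tendsto_of_le_of_le tendsto_const_nhds h1
    (fun _ => zero_le) fun n => ?_
  simp only
  rw [← setLIntegral_eq_of_support_subset (s := tsupport η),
    ← lintegral_const_mul' _ _ ENNReal.ofReal_ne_top]
  · refine lintegral_mono fun z => ?_
    rw [smul_eq_mul, ← mul_sub, enorm_mul]
    gcongr
    rw [← ofReal_norm]
    exact ENNReal.ofReal_le_ofReal (hM z)
  · intro z hz
    refine subset_tsupport η fun h => hz ?_
    simp [h]

/-! ### Green's identity against test functions, and averaging over level sets. -/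

namespace IsGreen

variable {N : ℕ} {Ω : Set (E N)} {e : E N} {Γ : E N → ℝ} {κ : ℝ}

lemma measurable (hG : IsGreen Ω e Γ κ) : Measurable Γ := by
  classical
  have h : Γ = (Ω \ {e}).piecewise Γ (fun _ => 0) := by
    ext z
    by_cases hz : z ∈ Ω \ {e}
    · simp [Set.piecewise_eq_of_mem _ _ _ hz]
    · rw [Set.piecewise_eq_of_notMem _ _ _ hz]
      by_cases hz' : z ∈ Ω
      · have : z = e := by by_contra h; exact hz ⟨hz', h⟩
        rw [this, hG.zero_pole]
      · exact hG.zero_off z hz'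
  rw [h]
  exact hG.continuousOn.measurable_piecewise continuousOn_const hG.isOpen_diff.measurableSet

lemma measurePreserving (hG : IsGreen Ω e Γ κ) (hN : 0 < N) :
    MeasurePreserving Γ (energy Ω e Γ) (ENNReal.ofReal κ • volume.restrict (Set.Ioi (0:ℝ))) :=
  ⟨hG.measurable, hG.map_energy hN⟩

lemma integral_comp (hG : IsGreen Ω e Γ κ) (hN : 0 < N) {F : ℝ → ℝ}
    (hF : AEStronglyMeasurable F (volume.restrict (Set.Ioi (0:ℝ)))) :
    ∫ z, F (Γ z) ∂(energy Ω e Γ) = κ * ∫ t in Set.Ioi (0:ℝ), F t := by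
  have h1 : AEStronglyMeasurable F ((energy Ω e Γ).map Γ) := by
    rw [hG.map_energy hN]; exact hF.smul_measure _
  rw [← integral_map hG.measurable.aemeasurable h1, hG.map_energy hN, integral_smul_measure,
    ENNReal.toReal_ofReal hG.const_pos.le, smul_eq_mul]

lemma integrable_comp (hG : IsGreen Ω e Γ κ) (hN : 0 < N) {F : ℝ → ℝ}
    (hF : AEStronglyMeasurable F (volume.restrict (Set.Ioi (0:ℝ)))) :
    Integrable (fun z => F (Γ z)) (energy Ω e Γ) ↔ IntegrableOn F (Set.Ioi (0:ℝ)) := by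
  have h1 : AEStronglyMeasurable F ((energy Ω e Γ).map Γ) := by
    rw [hG.map_energy hN]; exact hF.smul_measure _
  have h2 := integrable_map_measure h1 hG.measurable.aemeasurable
  rw [Function.comp_def] at h2
  rw [← h2, hG.map_energy hN, integrable_smul_measure (by simpa using hG.const_pos)
    ENNReal.ofReal_ne_top, IntegrableOn]

/-- Green's identity tested with `φ · H(Γ)`, where `H` vanishes at infinity and is constant near
`0`. -/
lemma integral_inner_gradient (hG : IsGreen Ω e Γ κ) (hN : 0 < N) {φ : E N → ℝ} (hφ : IsTest Ω φ)
    {a b : ℝ} (ha : 0 < a) {H h : ℝ → ℝ} {C : ℝ} (hH : ∀ t, HasDerivAt H (h t) t)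
    (hh : Continuous h) (h0 : ∀ t ≤ a, H t = C) (h1 : ∀ t, b ≤ t → H t = 0)
    (h0' : ∀ t ≤ a, h t = 0) (h1' : ∀ t, b ≤ t → h t = 0)
    (hL : MemLp (fun z => H (Γ z) • gradient Γ z) 2 (volume.restrict (Ω \ {e}))) :
    ∫ z in Ω \ {e}, inner ℝ (gradient φ z) (H (Γ z) • gradient Γ z) =
      - ∫ z, h (Γ z) * φ z ∂(energy Ω e Γ) := by
  have hHc : ContDiff ℝ 1 H := by
    rw [contDiff_one_iff_deriv]
    refine ⟨fun t => (hH t).differentiableAt, ?_⟩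
    rwa [show deriv H = h from funext fun t => (hH t).deriv]
  -- `η` is `H(Γ)` with value `0` at the pole. The composition lemmas need a profile vanishing near
  -- `0`, so they are applied to `H - C` and `C` is added back. Because `η` vanishes near the pole,
  -- the Dirac term disappears.
  set η : E N → ℝ := fun z => Function.update ((fun t => H t - C) ∘ Γ) e (-C) z + C with hη
  have hη0 : ∀ᶠ z in 𝓝 e, η z = 0 := by
    filter_upwards [hG.update_eventuallyEq (H := fun t => H t - C) (b := b) (C := -C)
      (fun t ht => by simp [h1 t ht])] with z hz
    simp [hη, hz]
  have hη1 : ContDiff ℝ 1 η :=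
    (hG.contDiff_update (n := 1) ha (b := b) (fun t ht => by simp [h0 t ht])
      (fun t ht => by simp [h1 t ht]) (hHc.sub contDiff_const)).add contDiff_const
  have hηU : ∀ z ∈ Ω \ {e}, η z = H (Γ z) := by
    intro z hz
    simp [hη, Function.update_of_ne (show z ≠ e from hz.2)]
  have hηg : ∀ z ∈ Ω \ {e}, gradient η z = h (Γ z) • gradient Γ z := by
    intro z hz
    have h3 := hG.gradient_update (C := -C) hz ((hH (Γ z)).sub_const C)
    rw [← h3]
    simp only [hη, gradient]
    rw [fderiv_add_const]
  have hφ1 : ContDiff ℝ 1 φ := hφ.1.of_le (by simp)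
  have hts : tsupport (fun z => η z * φ z) ⊆ tsupport φ := tsupport_mul_subset_right
  have hgr := hG.green (fun z => η z * φ z) (hη1.mul hφ1) hφ.2.1.mul_left (hts.trans hφ.2.2)
    (by filter_upwards [hη0] with z hz; simp [hz, hη0.self_of_nhds])
  rw [hη0.self_of_nhds, zero_mul, mul_zero, ← restrict_sdiff_singleton (Ω := Ω) (e := e) hN] at hgr
  have hgrad : ∀ z ∈ Ω \ {e}, inner ℝ (gradient (fun z => η z * φ z) z) (gradient Γ z) =
      inner ℝ (gradient φ z) (H (Γ z) • gradient Γ z) + ‖gradient Γ z‖ ^ 2 * (h (Γ z) * φ z) := by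
    intro z hz
    have h4 : HasGradientAt (fun z => η z * φ z) (η z • gradient φ z + φ z • gradient η z) z := by
      rw [hasGradientAt_iff_hasFDerivAt]
      have h5 := ((hη1.differentiable one_ne_zero z).hasFDerivAt).mul
        ((hφ1.differentiable one_ne_zero z).hasFDerivAt)
      simp only [gradient, map_add, map_smul, LinearIsometryEquiv.apply_symm_apply]
      exact h5
    rw [h4.gradient, hηg z hz, hηU z hz, inner_add_left, inner_smul_left, inner_smul_left,
      inner_smul_left, inner_smul_right, real_inner_self_eq_norm_sq]
    simp only [conj_trivial]
    ring
  rw [setIntegral_congr_fun hG.isOpen_diff.measurableSet hgrad, integral_add] at hgr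
  · rw [hG.integral_energy]
    linarith
  · exact integrable_inner_of_memLp ((hφ.memLp_gradient 2).restrict _) hL
  · have hp := hG.comp_props ha h0' h1' (n := 0) (contDiff_zero.2 hh)
    have hli : LocallyIntegrableOn (fun z => ‖gradient Γ z‖ ^ 2 * φ z) (Ω \ {e}) :=
      ((hG.continuousOn_gradient.norm.pow 2).mul hφ.1.continuous.continuousOn).locallyIntegrableOn
        hG.isOpen_diff.measurableSet
    refine (integrable_smul_of_tsupport_subset hp.1.continuous hp.2.1 hp.2.2 hli).restrict.congr ?_
    refine Eventually.of_forall fun z => ?_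
    simp only [Function.comp_apply, smul_eq_mul]
    ring

/-- The integral of `|H(Γ) ∇Γ|²` is the integral of `H(Γ)²` for the energy measure, that is, `κ ∫
H²`. -/
lemma memLp_smul_gradient (hG : IsGreen Ω e Γ κ) (hN : 0 < N) {H : ℝ → ℝ}
    (hm : Measurable H) (hH : MemLp H 2 (volume.restrict (Set.Ioi (0:ℝ)))) :
    MemLp (fun z => H (Γ z) • gradient Γ z) 2 (volume.restrict (Ω \ {e})) := by
  rw [memLp_two_iff_integrable_sq_norm]
  · have h1 := (hG.integrable_comp hN (F := fun t => H t ^ 2)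
      (hm.pow_const 2).aestronglyMeasurable).2 hH.integrable_sq
    rw [hG.integrable_energy_iff] at h1
    refine h1.congr (Eventually.of_forall fun z => ?_)
    simp [norm_smul, mul_pow, mul_comm]
  · exact (hm.comp hG.measurable).aestronglyMeasurable.smul
      (hG.continuousOn_gradient.aestronglyMeasurable hG.isOpen_diff.measurableSet)

/-- The part of a square integrable field `g` along `∇Γ`, averaged over the level sets of `Γ`. -/
lemma exists_average (hG : IsGreen Ω e Γ κ) (hN : 0 < N) {g : E N → E N}
    (hg : MemLp g 2 (volume.restrict (Ω \ {e}))) :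
    ∃ f : ℝ → ℝ, MemLp f 2 (volume.restrict (Set.Ioi (0:ℝ))) ∧
      κ * ∫ t in Set.Ioi (0:ℝ), f t ^ 2 ≤ ∫ z in Ω \ {e}, ‖g z‖ ^ 2 ∧
      ∀ H : ℝ → ℝ, Measurable H → MemLp H 2 (volume.restrict (Set.Ioi (0:ℝ))) →
        ∫ z in Ω \ {e}, inner ℝ (g z) (H (Γ z) • gradient Γ z) =
          κ * ∫ t in Set.Ioi (0:ℝ), f t * H t := by
  set μ := energy Ω e Γ
  set ν := ENNReal.ofReal κ • volume.restrict (Set.Ioi (0:ℝ)) with hν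
  have hmp : MeasurePreserving Γ μ ν := hG.measurePreserving hN
  have hgm := hG.continuousOn_gradient.aestronglyMeasurable
    hG.isOpen_diff.measurableSet (μ := volume)
  -- Normalised so that `g = ∇(w(Γ))` gives `b = w'(Γ)`.
  set b : E N → ℝ := fun z => inner ℝ (g z) (gradient Γ z) / ‖gradient Γ z‖ ^ 2 with hb
  have hbm : AEStronglyMeasurable b (volume.restrict (Ω \ {e})) :=
    ((hg.aestronglyMeasurable.inner hgm).aemeasurable.div
      (hgm.norm.aemeasurable.pow_const 2)).aestronglyMeasurable
  have hble : ∀ z, ‖gradient Γ z‖ ^ 2 * b z ^ 2 ≤ ‖g z‖ ^ 2 := by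
    intro z
    by_cases hz : gradient Γ z = 0
    · simp [hz]
    have h1 : 0 < ‖gradient Γ z‖ := norm_pos_iff.2 hz
    have h2 := abs_real_inner_le_norm (g z) (gradient Γ z)
    have h3 := sq_le_sq' (abs_le.1 h2).1 (abs_le.1 h2).2
    have : ‖gradient Γ z‖ ^ 2 * b z ^ 2 = inner ℝ (g z) (gradient Γ z) ^ 2 / ‖gradient Γ z‖ ^ 2 := by
      simp only [hb]; field_simp
    rw [this, div_le_iff₀ (by positivity)]
    nlinarith
  have hgi : IntegrableOn (fun z => ‖g z‖ ^ 2) (Ω \ {e}) :=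
    (memLp_two_iff_integrable_sq_norm hg.aestronglyMeasurable).1 hg
  have hbi : IntegrableOn (fun z => ‖gradient Γ z‖ ^ 2 * b z ^ 2) (Ω \ {e}) := by
    refine hgi.mono' ((hgm.norm.pow 2).mul (hbm.pow 2)) (Eventually.of_forall fun z => ?_)
    rw [Real.norm_of_nonneg (by positivity)]
    exact hble z
  have hbL : MemLp b 2 μ := by
    rw [memLp_two_iff_integrable_sq (hbm.mono_ac energy_ac)]
    rw [hG.integrable_energy_iff]
    exact hbi
  -- Composition with `Γ` is an isometry into `L²` of the energy measure. Its adjoint is the average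
  -- over level sets; being a contraction, it gives the energy bound.
  set T := Lp.compMeasurePreservingₗᵢ (E := ℝ) (p := 2) ℝ Γ hmp
  set f := ContinuousLinearMap.adjoint T.toContinuousLinearMap (hbL.toLp b) with hf
  have hfν : MemLp (f : ℝ → ℝ) 2 ν := Lp.memLp f
  have hfL : MemLp (f : ℝ → ℝ) 2 (volume.restrict (Set.Ioi (0:ℝ))) := by
    have := hfν.smul_measure (c := (ENNReal.ofReal κ)⁻¹) (by simpa using hG.const_pos)
    have hνv : (ENNReal.ofReal κ)⁻¹ • ν = volume.restrict (Set.Ioi (0:ℝ)) := by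
      rw [hν, smul_smul, ENNReal.inv_mul_cancel (by simpa using hG.const_pos)
        ENNReal.ofReal_ne_top, one_smul]
    exact hνv ▸ this
  have hint : ∀ F : ℝ → ℝ, ∫ t, F t ∂ν = κ * ∫ t in Set.Ioi (0:ℝ), F t := by
    intro F
    rw [hν, integral_smul_measure, ENNReal.toReal_ofReal hG.const_pos.le, smul_eq_mul]
  refine ⟨f, hfL, ?_, ?_⟩
  · have h1 : ‖f‖ ≤ ‖hbL.toLp b‖ := by
      refine (ContinuousLinearMap.le_opNorm _ _).trans ?_
      rw [LinearIsometryEquiv.norm_map]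
      refine mul_le_of_le_one_left (norm_nonneg _) T.norm_toContinuousLinearMap_le
    have h2 : ‖f‖ ^ 2 = κ * ∫ t in Set.Ioi (0:ℝ), f t ^ 2 := by
      rw [← real_inner_self_eq_norm_sq, L2.inner_def, hint]
      simp [sq]
    have h3 : ‖hbL.toLp b‖ ^ 2 = ∫ z in Ω \ {e}, ‖gradient Γ z‖ ^ 2 * b z ^ 2 := by
      rw [← real_inner_self_eq_norm_sq, inner_toLp, hG.integral_energy]
      simp [sq]
    rw [← h2]
    refine (pow_le_pow_left₀ (norm_nonneg _) h1 2).trans ?_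
    rw [h3]
    exact setIntegral_mono hbi hgi fun z => hble z
  · intro H hm hH
    have hHν : MemLp H 2 ν := hH.smul_measure ENNReal.ofReal_ne_top
    have h1 : inner ℝ f (hHν.toLp H) = inner ℝ (hbL.toLp b) (T (hHν.toLp H)) :=
      ContinuousLinearMap.adjoint_inner_left _ _ _
    have h2 : inner ℝ f (hHν.toLp H) = κ * ∫ t in Set.Ioi (0:ℝ), f t * H t := by
      rw [L2.inner_def, ← hint]
      refine integral_congr_ae ?_
      filter_upwards [hHν.coeFn_toLp] with t ht
      rw [ht]
      simp [mul_comm]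
    have h3 : inner ℝ (hbL.toLp b) (T (hHν.toLp H)) = ∫ z, b z * H (Γ z) ∂μ := by
      rw [L2.inner_def]
      refine integral_congr_ae ?_
      have h4 := Lp.coeFn_compMeasurePreserving (hHν.toLp H) hmp
      filter_upwards [hbL.coeFn_toLp, h4, hmp.quasiMeasurePreserving.ae_eq_comp hHν.coeFn_toLp]
        with z hz1 hz2 hz3
      have hz4 : (T (hHν.toLp H)) z = H (Γ z) := hz2.trans hz3
      rw [hz1, hz4]
      simp [mul_comm]
    rw [← h2, h1, h3, hG.integral_energy]
    refine setIntegral_congr_fun hG.isOpen_diff.measurableSet fun z hz => ?_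
    have hz' := hG.gradient_ne z hz
    simp only [hb, inner_smul_right]
    field_simp [norm_ne_zero_iff.2 hz']

end IsGreen

/-! ### Profiles on `(0,∞)` and density of their derivatives. -/

/-- Smooth functions on the line supported in a compact subset of `(0, ∞)`. -/
def IsProfile (w : ℝ → ℝ) : Prop :=
  ContDiff ℝ ∞ w ∧ ∃ a > 0, ∃ b ≥ a, (∀ t ≤ a, w t = 0) ∧ ∀ t, b ≤ t → w t = 0

lemma exists_bounds {h : ℝ → ℝ} (hc : HasCompactSupport h) (hs : tsupport h ⊆ Set.Ioi 0) :
    ∃ a > 0, ∃ b ≥ a, (∀ t ≤ a, h t = 0) ∧ ∀ t, b ≤ t → h t = 0 := by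
  rcases (tsupport h).eq_empty_or_nonempty with he | hne
  · have h0 : ∀ t, h t = 0 := fun t => image_eq_zero_of_notMem_tsupport (by simp [he])
    exact ⟨1, one_pos, 1, le_rfl, fun t _ => h0 t, fun t _ => h0 t⟩
  · have hm := hc.isCompact.sInf_mem hne
    have hM := hc.isCompact.sSup_mem hne
    have h0 : 0 < sInf (tsupport h) := hs hm
    have h1 : sInf (tsupport h) ≤ sSup (tsupport h) := csInf_le hc.isCompact.bddBelow hM
    refine ⟨sInf (tsupport h) / 2, by positivity, sSup (tsupport h) + 1, by linarith,
      fun t ht => ?_, fun t ht => ?_⟩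
    · refine image_eq_zero_of_notMem_tsupport fun h' => ?_
      linarith [csInf_le hc.isCompact.bddBelow h']
    · refine image_eq_zero_of_notMem_tsupport fun h' => ?_
      linarith [le_csSup hc.isCompact.bddAbove h']

lemma hasCompactSupport_of_bounds {h : ℝ → ℝ} {a b : ℝ} (h0 : ∀ t ≤ a, h t = 0)
    (h1 : ∀ t, b ≤ t → h t = 0) : HasCompactSupport h :=
  HasCompactSupport.of_support_subset_isCompact (isCompact_Icc (a := a) (b := b)) fun _ ht =>
    ⟨le_of_lt (not_le.1 fun h' => ht (h0 _ h')), le_of_lt (not_le.1 fun h' => ht (h1 _ h'))⟩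

namespace IsProfile

variable {w : ℝ → ℝ}

lemma continuous_deriv (hw : IsProfile w) : Continuous (deriv w) :=
  hw.1.continuous_deriv (by simp)

lemma hasDerivAt (hw : IsProfile w) (t : ℝ) : HasDerivAt w (deriv w t) t :=
  (hw.1.differentiable (by simp) t).hasDerivAt

lemma hasCompactSupport (hw : IsProfile w) : HasCompactSupport w := by
  obtain ⟨-, a, -, b, -, h0, h1⟩ := hw
  exact hasCompactSupport_of_bounds h0 h1

lemma memLp_deriv (hw : IsProfile w) : MemLp (deriv w) 2 (volume.restrict (Set.Ioi (0:ℝ))) :=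
  (hw.continuous_deriv.memLp_of_hasCompactSupport hw.hasCompactSupport.deriv).restrict _

lemma intervalIntegral_deriv (hw : IsProfile w) (t : ℝ) : ∫ s in (0:ℝ)..t, deriv w s = w t := by
  rw [intervalIntegral.integral_deriv_eq_sub (fun x _ => (hw.hasDerivAt x).differentiableAt)
    (hw.continuous_deriv.intervalIntegrable _ _)]
  obtain ⟨-, a, ha, b, -, h0, -⟩ := hw
  rw [h0 0 ha.le, sub_zero]

end IsProfile

lemma intervalIntegrable_of_memLp {f : ℝ → ℝ} (hf : MemLp f 2 (volume.restrict (Set.Ioi (0:ℝ))))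
    {t : ℝ} (ht : 0 ≤ t) : IntervalIntegrable f volume 0 t := by
  rw [intervalIntegrable_iff_integrableOn_Ioc_of_le ht]
  have h1 : MemLp f 2 (volume.restrict (Set.Ioc 0 t)) :=
    hf.mono_measure (Measure.restrict_mono_set _ Set.Ioc_subset_Ioi_self)
  exact h1.integrable (by norm_num)

/-- Cauchy–Schwarz against the constant `1` on `(0,t]`. It turns `L²` convergence of derivatives
into pointwise convergence of primitives. -/
lemma sq_intervalIntegral_le {f : ℝ → ℝ} (hf : MemLp f 2 (volume.restrict (Set.Ioi (0:ℝ))))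
    {t : ℝ} (ht : 0 ≤ t) :
    (∫ s in (0:ℝ)..t, f s) ^ 2 ≤ t * ∫ s in Set.Ioi (0:ℝ), f s ^ 2 := by
  have h1 : MemLp f 2 (volume.restrict (Set.Ioc 0 t)) :=
    hf.mono_measure (Measure.restrict_mono_set _ Set.Ioc_subset_Ioi_self)
  have h2 : MemLp (fun _ : ℝ => (1:ℝ)) 2 (volume.restrict (Set.Ioc 0 t)) := memLp_const 1
  have h3 := real_inner_mul_inner_self_le (h1.toLp f) (h2.toLp _)
  rw [inner_toLp, inner_toLp, inner_toLp] at h3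
  simp only [RCLike.inner_apply, conj_trivial, one_mul, integral_const, smul_eq_mul, mul_one] at h3
  rw [intervalIntegral.integral_of_le ht, sq]
  refine h3.trans ?_
  simp only [measureReal_restrict_apply_univ, Real.volume_real_Ioc_of_le ht, sub_zero]
  rw [mul_comm]
  refine mul_le_mul_of_nonneg_left ?_ ht
  simp_rw [← sq]
  exact setIntegral_mono_set hf.integrable_sq (Eventually.of_forall fun x => sq_nonneg _)
    Set.Ioc_subset_Ioi_self.eventuallyLE

lemma continuousOn_prim {f : ℝ → ℝ} (hf : MemLp f 2 (volume.restrict (Set.Ioi (0:ℝ)))) :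
    ContinuousOn (fun t => ∫ s in (0:ℝ)..t, f s) (Set.Ioi 0) := by
  intro t ht
  have h1 := intervalIntegral.continuousOn_primitive_interval'
    (intervalIntegrable_of_memLp hf (t := t + 1) (by linarith [Set.mem_Ioi.1 ht]))
    Set.left_mem_uIcc
  have ht0 := Set.mem_Ioi.1 ht
  rw [Set.uIcc_of_le (by linarith)] at h1
  exact (h1.continuousAt (Icc_mem_nhds ht0 (by linarith))).continuousWithinAt

/-- Integration by parts against a square integrable function. -/
lemma integral_mul_primitive {f h : ℝ → ℝ} (hf : MemLp f 2 (volume.restrict (Set.Ioi (0:ℝ))))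
    (hh : Continuous h) {b : ℝ} (hb : 0 ≤ b) (h1 : ∀ t, b ≤ t → h t = 0) :
    ∫ t in Set.Ioi (0:ℝ), f t * ∫ s in b..t, h s =
      - ∫ t in Set.Ioi (0:ℝ), h t * ∫ s in (0:ℝ)..t, f s := by
  set ν := (volume : Measure ℝ).restrict (Set.Ioc 0 b) with hν
  have hfi : Integrable f ν := (intervalIntegrable_iff_integrableOn_Ioc_of_le hb).1
    (intervalIntegrable_of_memLp hf hb)
  have hhi : Integrable h ν := (intervalIntegrable_iff_integrableOn_Ioc_of_le hb).1
    (hh.intervalIntegrable 0 b)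
  -- As `f` is only square integrable, the integration by parts is Fubini's theorem on the triangle
  -- `t < s` inside `(0,b]²`.
  have hS : MeasurableSet {p : ℝ × ℝ | p.1 < p.2} := measurableSet_lt measurable_fst measurable_snd
  have hΦ : Integrable (Function.uncurry fun t s => {p : ℝ × ℝ | p.1 < p.2}.indicator
      (fun p => f p.1 * h p.2) (t, s)) (ν.prod ν) := (hfi.mul_prod hhi).indicator hS
  have hsw := integral_integral_swap hΦ
  have hl : ∫ t in Set.Ioi (0:ℝ), f t * ∫ s in b..t, h s = ∫ t, f t * (∫ s in b..t, h s) ∂ν := by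
    rw [hν, ← integral_indicator measurableSet_Ioi, ← integral_indicator measurableSet_Ioc]
    congr 1; ext t
    by_cases ht : t ∈ Set.Ioc 0 b
    · rw [Set.indicator_of_mem ht, Set.indicator_of_mem (Set.Ioc_subset_Ioi_self ht)]
    · rw [Set.indicator_of_notMem ht]
      by_cases ht' : t ∈ Set.Ioi 0
      · rw [Set.indicator_of_mem ht']
        have htb : b < t := not_le.1 fun h' => ht ⟨ht', h'⟩
        rw [intervalIntegral.integral_of_le htb.le, setIntegral_eq_zero_of_forall_eq_zero, mul_zero]
        exact fun s hs => h1 s hs.1.le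
      · rw [Set.indicator_of_notMem ht']
  have hr : ∫ t in Set.Ioi (0:ℝ), h t * ∫ s in (0:ℝ)..t, f s =
      ∫ t, h t * (∫ s in (0:ℝ)..t, f s) ∂ν := by
    rw [hν, ← integral_indicator measurableSet_Ioi, ← integral_indicator measurableSet_Ioc]
    congr 1; ext t
    by_cases ht : t ∈ Set.Ioc 0 b
    · rw [Set.indicator_of_mem ht, Set.indicator_of_mem (Set.Ioc_subset_Ioi_self ht)]
    · rw [Set.indicator_of_notMem ht]
      by_cases ht' : t ∈ Set.Ioi 0
      · rw [Set.indicator_of_mem ht', h1 t (not_le.1 fun h' => ht ⟨ht', h'⟩).le, zero_mul]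
      · rw [Set.indicator_of_notMem ht']
  have hl' : ∀ t ∈ Set.Ioc 0 b, ∫ s, {p : ℝ × ℝ | p.1 < p.2}.indicator
      (fun p => f p.1 * h p.2) (t, s) ∂ν = - (f t * ∫ s in b..t, h s) := by
    intro t ht
    have : ∀ s, {p : ℝ × ℝ | p.1 < p.2}.indicator (fun p => f p.1 * h p.2) (t, s) =
        (Set.Ioi t).indicator (fun s => f t * h s) s := fun s => by
      simp [Set.indicator_apply]
    simp_rw [this]
    rw [integral_indicator measurableSet_Ioi, hν, Measure.restrict_restrict measurableSet_Ioi,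
      integral_const_mul, intervalIntegral.integral_symm, intervalIntegral.integral_of_le ht.2,
      mul_neg, neg_neg]
    congr 3
    ext s
    simp only [Set.mem_inter_iff, Set.mem_Ioi, Set.mem_Ioc]
    exact ⟨fun h => ⟨h.1, h.2.2⟩, fun h => ⟨h.1, ht.1.trans h.1, h.2⟩⟩
  have hr' : ∀ s ∈ Set.Ioc 0 b, ∫ t, {p : ℝ × ℝ | p.1 < p.2}.indicator
      (fun p => f p.1 * h p.2) (t, s) ∂ν = h s * ∫ t in (0:ℝ)..s, f t := by
    intro s hs
    have : ∀ t, {p : ℝ × ℝ | p.1 < p.2}.indicator (fun p => f p.1 * h p.2) (t, s) =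
        (Set.Iio s).indicator (fun t => f t * h s) t := fun t => by
      simp [Set.indicator_apply]
    simp_rw [this]
    rw [integral_indicator measurableSet_Iio, hν, Measure.restrict_restrict measurableSet_Iio,
      integral_mul_const, intervalIntegral.integral_of_le hs.1.le, mul_comm,
      integral_Ioc_eq_integral_Ioo]
    congr 3
    ext t
    simp only [Set.mem_inter_iff, Set.mem_Iio, Set.mem_Ioc, Set.mem_Ioo]
    exact ⟨fun h => ⟨h.2.1, h.1⟩, fun h => ⟨h.2, h.1, h.2.le.trans hs.2⟩⟩
  rw [hl, hr]
  have e1 : ∫ t, ∫ s, {p : ℝ × ℝ | p.1 < p.2}.indicator (fun p => f p.1 * h p.2) (t, s) ∂ν ∂ν =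
      ∫ t, - (f t * ∫ s in b..t, h s) ∂ν := setIntegral_congr_fun measurableSet_Ioc hl'
  have e2 : ∫ s, ∫ t, {p : ℝ × ℝ | p.1 < p.2}.indicator (fun p => f p.1 * h p.2) (t, s) ∂ν ∂ν =
      ∫ t, h t * (∫ s in (0:ℝ)..t, f s) ∂ν := setIntegral_congr_fun measurableSet_Ioc hr'
  rw [← e2, ← hsw, e1, integral_neg, neg_neg]

/-- Square integrable functions orthogonal to all derivatives of profiles vanish. -/
lemma ae_eq_zero_of_integral_mul_deriv {f : ℝ → ℝ}
    (hf : MemLp f 2 (volume.restrict (Set.Ioi (0:ℝ))))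
    (h : ∀ w, IsProfile w → ∫ t in Set.Ioi (0:ℝ), f t * deriv w t = 0) :
    f =ᵐ[volume.restrict (Set.Ioi (0:ℝ))] 0 := by
  let θ : ContDiffBump (2:ℝ) := ⟨1/2, 1, by norm_num, by norm_num⟩
  set B : ℝ → ℝ := θ.normed volume with hB
  have hBc : ContDiff ℝ ∞ B := θ.contDiff_normed
  have hBs : ∀ t, t ∉ Set.Ioo (1:ℝ) 3 → B t = 0 := by
    intro t ht
    by_contra h'
    have h2 : t ∈ Function.support B := h'
    rw [hB, θ.support_normed_eq, Real.ball_eq_Ioo] at h2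
    norm_num at h2 ht
    linarith [ht h2.1]
  have hB0 : ∀ t ≤ 1, B t = 0 := fun t ht => hBs t fun h => by linarith [h.1]
  have hB1 : ∀ t, 3 ≤ t → B t = 0 := fun t ht => hBs t fun h => by linarith [h.2]
  have hBi : ∫ t, B t = 1 := θ.integral_normed
  -- Du Bois-Reymond's argument: for a test function `φ`, the function `φ - (∫ φ) B` has mean zero
  -- and so is the derivative of a profile. Hence `f` is constant, equal to `k`.
  set k := ∫ t in Set.Ioi (0:ℝ), f t * B t with hk
  have hmemLp : ∀ φ : ℝ → ℝ, Continuous φ → HasCompactSupport φ →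
      Integrable (fun t => f t * φ t) (volume.restrict (Set.Ioi (0:ℝ))) := by
    intro φ h1 h2
    have := integrable_inner_of_memLp hf
      ((h1.memLp_of_hasCompactSupport (p := 2) (μ := volume) h2).restrict (Set.Ioi (0:ℝ)))
    simpa [mul_comm] using this
  have hloc : LocallyIntegrableOn f (Set.Ioi 0) := by
    intro t ht
    have h1 := intervalIntegrable_of_memLp hf (t := t + 1) (by linarith [Set.mem_Ioi.1 ht])
    have ht' := Set.mem_Ioi.1 ht
    rw [intervalIntegrable_iff_integrableOn_Ioc_of_le (by linarith)] at h1
    exact ⟨Set.Ioc 0 (t + 1), mem_nhdsWithin_of_mem_nhds (Ioc_mem_nhds ht' (by linarith)), h1⟩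
  have key := isOpen_Ioi.ae_eq_zero_of_integral_contDiff_smul_eq_zero (μ := volume)
    (f := fun t => f t - k) (U := Set.Ioi (0:ℝ)) (hloc.sub (continuousOn_const.locallyIntegrableOn
      measurableSet_Ioi)) (fun φ hφ hφc hφs => ?_)
  · have h2 : f =ᵐ[volume.restrict (Set.Ioi (0:ℝ))] fun _ => k := by
      rw [EventuallyEq, ae_restrict_iff' measurableSet_Ioi]
      filter_upwards [key] with t ht ht0 using sub_eq_zero.1 (ht ht0)
    -- The half-line has infinite measure, so a square integrable constant is zero.
    have h3 : MemLp (fun _ : ℝ => k) 2 (volume.restrict (Set.Ioi (0:ℝ))) := hf.ae_eq h2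
    rw [memLp_const_iff (by norm_num) (by norm_num)] at h3
    simp at h3
    rw [h3] at h2
    exact h2
  · obtain ⟨a, ha, b, hab, h0, h1⟩ := exists_bounds hφc hφs
    set c := ∫ t, φ t with hc
    set ψ : ℝ → ℝ := fun t => φ t - c * B t with hψ
    have hψc : ContDiff ℝ ∞ ψ := hφ.sub (contDiff_const.mul hBc)
    have hψ0 : ∀ t ≤ min a 1, ψ t = 0 := fun t ht => by
      simp [hψ, h0 t (ht.trans (min_le_left _ _)), hB0 t (ht.trans (min_le_right _ _))]
    have hψ1 : ∀ t, max b 3 ≤ t → ψ t = 0 := fun t ht => by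
      simp [hψ, h1 t ((le_max_left _ _).trans ht), hB1 t ((le_max_right _ _).trans ht)]
    have hφi : Integrable φ := hφ.continuous.integrable_of_hasCompactSupport hφc
    have hBint : Integrable B :=
      hBc.continuous.integrable_of_hasCompactSupport θ.hasCompactSupport_normed
    have hψi : ∫ t, ψ t = 0 := by
      rw [hψ, integral_sub hφi (hBint.const_mul c), integral_const_mul, hBi, mul_one, sub_self]
    set w : ℝ → ℝ := fun t => ∫ s in (0:ℝ)..t, ψ s with hw
    have hwd : ∀ t, HasDerivAt w (ψ t) t := fun t =>
      (hψc.continuous.integral_hasStrictDerivAt 0 t).hasDerivAt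
    have hmin : 0 < min a 1 := lt_min ha one_pos
    have hmax : 0 ≤ max b 3 := le_trans (by norm_num) (le_max_right b 3)
    have hwp : IsProfile w := by
      refine ⟨?_, min a 1, hmin, max b 3, ?_, fun t ht => ?_, fun t ht => ?_⟩
      · rw [show (∞ : WithTop ℕ∞) = ∞ + 1 from rfl, contDiff_succ_iff_deriv]
        refine ⟨fun t => (hwd t).differentiableAt, by simp, ?_⟩
        rwa [show deriv w = ψ from funext fun t => (hwd t).deriv]
      · exact (min_le_left a 1).trans (hab.trans (le_max_left _ _))
      · refine intervalIntegral.integral_zero_ae (f := ψ)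
          (Eventually.of_forall fun x hx => hψ0 x ?_)
        exact hx.2.trans (max_le hmin.le ht)
      · rw [← hψi, hw]
        dsimp only
        rw [intervalIntegral.integral_of_le (hmax.trans ht),
          setIntegral_eq_integral_of_forall_compl_eq_zero]
        intro x hx
        simp only [Set.mem_Ioc, not_and_or, not_lt, not_le] at hx
        rcases hx with hx | hx
        · exact hψ0 _ (hx.trans hmin.le)
        · exact hψ1 _ (ht.trans hx.le)
    have h2 := h w hwp
    rw [show deriv w = ψ from funext fun t => (hwd t).deriv] at h2
    have h3 : ∫ t in Set.Ioi (0:ℝ), f t * ψ t = (∫ t in Set.Ioi (0:ℝ), f t * φ t) - c * k := by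
      rw [hk, ← integral_const_mul, ← integral_sub (hmemLp φ hφ.continuous hφc)
        ((hmemLp B hBc.continuous θ.hasCompactSupport_normed).const_mul c)]
      refine integral_congr_ae (Eventually.of_forall fun t => ?_)
      simp only [hψ]; ring
    have hzero : ∀ x ∉ Set.Ioi (0:ℝ), φ x = 0 := fun x hx => h0 x ((not_lt.1 hx).trans ha.le)
    rw [← setIntegral_eq_integral_of_forall_compl_eq_zero (s := Set.Ioi (0:ℝ))
      (fun x hx => by simp [hzero x hx])]
    have h4 : ∫ t in Set.Ioi (0:ℝ), φ t = c :=
      setIntegral_eq_integral_of_forall_compl_eq_zero hzero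
    have h5 : ∫ t in Set.Ioi (0:ℝ), φ t • (f t - k) =
        (∫ t in Set.Ioi (0:ℝ), f t * φ t) - (∫ t in Set.Ioi (0:ℝ), φ t) * k := by
      rw [← integral_mul_const, ← integral_sub (hmemLp φ hφ.continuous hφc)
        (hφi.restrict.mul_const k)]
      refine integral_congr_ae (Eventually.of_forall fun t => ?_)
      simp only [smul_eq_mul]; ring
    rw [h5, h4, ← h3, h2]

/-- Derivatives of profiles are dense in `L²(0, ∞)`. -/
lemma exists_profile_tendsto {f : ℝ → ℝ} (hf : MemLp f 2 (volume.restrict (Set.Ioi (0:ℝ)))) :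
    ∃ w : ℕ → ℝ → ℝ, (∀ n, IsProfile (w n)) ∧ Tendsto (fun n =>
      eLpNorm (fun t => deriv (w n) t - f t) 2 (volume.restrict (Set.Ioi (0:ℝ)))) atTop (𝓝 0) := by
  let K : Submodule ℝ (Lp ℝ 2 (volume.restrict (Set.Ioi (0:ℝ)))) :=
    { carrier := {F | ∃ w, ∃ hw : IsProfile w, F = hw.memLp_deriv.toLp _}
      zero_mem' := by
        refine ⟨fun _ => 0, ⟨contDiff_const, 1, one_pos, 1, le_rfl, by simp, by simp⟩, ?_⟩
        rw [eq_comm, Lp.eq_zero_iff_ae_eq_zero]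
        refine (MemLp.coeFn_toLp _).trans (Eventually.of_forall fun t => ?_)
        simp
      add_mem' := by
        rintro _ _ ⟨w₁, hw₁, rfl⟩ ⟨w₂, hw₂, rfl⟩
        have hw : IsProfile (w₁ + w₂) := by
          obtain ⟨c1, a, ha, b, hab, h0, h1⟩ := hw₁
          obtain ⟨c2, a', ha', b', hab', h0', h1'⟩ := hw₂
          refine ⟨c1.add c2, min a a', lt_min ha ha', max b b',
            (min_le_left _ _).trans (hab.trans (le_max_left _ _)), fun t ht => ?_, fun t ht => ?_⟩
          · simp [h0 t (ht.trans (min_le_left _ _)), h0' t (ht.trans (min_le_right _ _))]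
          · simp [h1 t ((le_max_left _ _).trans ht), h1' t ((le_max_right _ _).trans ht)]
        refine ⟨_, hw, ?_⟩
        rw [← MemLp.toLp_add]
        congr 1
        ext t
        exact (((hw₁.hasDerivAt t).add (hw₂.hasDerivAt t)).deriv).symm
      smul_mem' := by
        rintro c _ ⟨w₁, hw₁, rfl⟩
        have hw : IsProfile (c • w₁) := by
          obtain ⟨c1, a, ha, b, hab, h0, h1⟩ := hw₁
          refine ⟨contDiff_const.smul c1, a, ha, b, hab, fun t ht => ?_, fun t ht => ?_⟩
          · simp [h0 t ht]
          · simp [h1 t ht]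
        refine ⟨_, hw, ?_⟩
        rw [← MemLp.toLp_const_smul]
        congr 1
        ext t
        exact (((hw₁.hasDerivAt t).const_smul c).deriv).symm }
  -- In a Hilbert space a subspace is dense once its orthogonal complement is trivial.
  have hK : K.topologicalClosure = ⊤ := by
    rw [Submodule.topologicalClosure_eq_top_iff, Submodule.eq_bot_iff]
    intro F hF
    rw [Submodule.mem_orthogonal'] at hF
    rw [Lp.eq_zero_iff_ae_eq_zero]
    refine ae_eq_zero_of_integral_mul_deriv (Lp.memLp F) fun w hw => ?_
    have h1 := hF _ ⟨w, hw, rfl⟩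
    rw [L2.inner_def] at h1
    refine Eq.trans (integral_congr_ae ?_) h1
    filter_upwards [hw.memLp_deriv.coeFn_toLp] with t ht
    rw [ht]
    simp [mul_comm]
  have hmem : hf.toLp f ∈ closure (K : Set (Lp ℝ 2 (volume.restrict (Set.Ioi (0:ℝ))))) := by
    rw [← Submodule.topologicalClosure_coe, hK]; trivial
  obtain ⟨F, hF, hlim⟩ := mem_closure_iff_seq_limit.1 hmem
  choose w hw hFw using hF
  refine ⟨w, hw, ?_⟩
  have h2 := (Lp.tendsto_Lp_iff_tendsto_eLpNorm'' (fun n => deriv (w n))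
    (fun n => (hw n).memLp_deriv) f hf).1 (by simpa [← hFw] using hlim)
  exact h2

/-! ### One-dimensional weighted inequalities. -/

namespace IsProfile

variable {w : ℝ → ℝ}

lemma integrableOn_comp (hw : IsProfile w) {F : ℝ → ℝ → ℝ} (hF0 : ∀ t, F t 0 = 0)
    (hF : ContinuousOn (Function.uncurry F) (Set.Ioi 0 ×ˢ Set.univ)) :
    IntegrableOn (fun t => F t (w t)) (Set.Ioi 0) := by
  obtain ⟨c1, a, ha, b, hab, h0, h1⟩ := hw
  have hwc := c1.continuous
  have hc : ContinuousOn (fun t => F t (w t)) (Set.Icc a b) := by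
    refine hF.comp (f := fun t => (t, w t)) (by fun_prop) fun t ht => ⟨ha.trans_le ht.1, trivial⟩
  have h2 : IntegrableOn (fun t => F t (w t)) (Set.Icc a b) := hc.integrableOn_Icc
  rw [integrableOn_iff_integrable_of_support_subset] at h2
  · exact h2.integrableOn
  · intro t ht
    refine ⟨le_of_lt (not_le.1 fun h' => ht ?_), le_of_lt (not_le.1 fun h' => ht ?_)⟩
    · simp [h0 t h', hF0]
    · simp [h1 t h', hF0]

/-- The one-dimensional Hardy inequality. -/
lemma hardy (hw : IsProfile w) :
    ∫ t in Set.Ioi (0:ℝ), w t ^ 2 / t ^ 2 ≤ 4 * ∫ t in Set.Ioi (0:ℝ), deriv w t ^ 2 := by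
  have hd := hw.hasDerivAt
  have hdc := hw.continuous_deriv
  have hi1 : IntegrableOn (fun t => w t ^ 2 / t ^ 2) (Set.Ioi 0) := by
    refine hw.integrableOn_comp (F := fun t x => x ^ 2 / t ^ 2) (by simp) ?_
    refine ContinuousOn.div (by fun_prop) (by fun_prop) fun p hp => ?_
    have : 0 < p.1 := hp.1
    positivity
  have hi2 : IntegrableOn (fun t => deriv w t ^ 2) (Set.Ioi 0) := hw.memLp_deriv.integrable_sq
  obtain ⟨c1, a, ha, b, hab, h0, h1⟩ := hw
  -- Chosen so that `4 w'² - w²/t² - 4 G' = (2 w' - w/t)²`, while `∫ G' = 0` because `w` vanishes at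
  -- both ends.
  set G : ℝ → ℝ := fun t => w t ^ 2 / (2 * t) with hG
  set G' : ℝ → ℝ := fun t => w t * deriv w t / t - w t ^ 2 / (2 * t ^ 2) with hG'
  have hGd : ∀ t ∈ Set.Icc a b, HasDerivAt G (G' t) t := by
    intro t ht
    have ht0 : 0 < t := ha.trans_le ht.1
    have := ((hd t).pow 2).div ((hasDerivAt_id t).const_mul 2) (by simp [ht0.ne'])
    refine this.congr_deriv ?_
    simp only [hG', id]
    field_simp
    simp
    ring
  have hGc : ContinuousOn G' (Set.Icc a b) := by
    have hne : ∀ t ∈ Set.Icc a b, t ≠ 0 := fun t ht => (ha.trans_le ht.1).ne'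
    have hwc := c1.continuous
    refine ContinuousOn.sub (ContinuousOn.div (by fun_prop) (by fun_prop) hne)
      (ContinuousOn.div (by fun_prop) (by fun_prop) fun t ht => ?_)
    simp [hne t ht]
  have hGi : IntervalIntegrable G' volume a b := by
    rw [← Set.uIcc_of_le hab] at hGc
    exact hGc.intervalIntegrable
  have hI : ∫ t in a..b, G' t = 0 := by
    rw [intervalIntegral.integral_eq_sub_of_hasDerivAt (f := G)
      (by rw [Set.uIcc_of_le hab]; exact hGd) hGi]
    simp [hG, h0 a le_rfl, h1 b le_rfl]
  rw [intervalIntegral.integral_of_le hab] at hI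
  rw [intervalIntegrable_iff_integrableOn_Ioc_of_le hab] at hGi
  have hsub : Set.Ioc a b ⊆ Set.Ioi 0 := fun t ht => ha.trans ht.1
  have e1 : ∫ t in Set.Ioi (0:ℝ), w t ^ 2 / t ^ 2 = ∫ t in Set.Ioc a b, w t ^ 2 / t ^ 2 := by
    refine (setIntegral_eq_of_subset_of_forall_sdiff_eq_zero measurableSet_Ioi hsub
      fun t ht => ?_)
    have : w t = 0 := by
      by_cases h : t ≤ a
      · exact h0 t h
      · exact h1 t (le_of_lt (not_le.1 fun h' => ht.2 ⟨not_le.1 h, h'⟩))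
    simp [this]
  have e2 : ∫ t in Set.Ioc a b, deriv w t ^ 2 ≤ ∫ t in Set.Ioi (0:ℝ), deriv w t ^ 2 :=
    setIntegral_mono_set hi2 (Eventually.of_forall fun t => sq_nonneg _) hsub.eventuallyLE
  have e3 : ∫ t in Set.Ioc a b, (w t ^ 2 / t ^ 2 + 4 * G' t) ≤
      ∫ t in Set.Ioc a b, 4 * deriv w t ^ 2 := by
    refine setIntegral_mono_on ((hi1.mono_set hsub).add (hGi.const_mul 4))
      ((hi2.mono_set hsub).const_mul 4) measurableSet_Ioc fun t ht => ?_
    have ht0 : 0 < t := hsub ht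
    have : 4 * deriv w t ^ 2 - (w t ^ 2 / t ^ 2 + 4 * G' t) = (2 * deriv w t - w t / t) ^ 2 := by
      simp only [hG']; field_simp; ring
    nlinarith [sq_nonneg (2 * deriv w t - w t / t)]
  rw [integral_add (hi1.mono_set hsub) (hGi.const_mul 4), integral_const_mul, hI,
    integral_const_mul] at e3
  rw [e1]
  linarith

lemma integrableOn_weight (hw : IsProfile w) {p : ℝ} (hp : 0 < p) (q : ℝ) :
    IntegrableOn (fun t => |w t| ^ p * t ^ q) (Set.Ioi 0) := by
  refine hw.integrableOn_comp (F := fun t x => |x| ^ p * t ^ q)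
    (by simp [Real.zero_rpow hp.ne']) ?_
  refine ContinuousOn.mul ?_ ?_
  · refine ContinuousOn.rpow_const (by fun_prop) fun x _ => Or.inr hp.le
  · refine ContinuousOn.rpow_const (by fun_prop) fun x hx => Or.inl (ne_of_gt hx.1)

/-- The integrand is `(w²/t)^(p/2-1) · w²/t²`. Cauchy–Schwarz gives `w²/t ≤ ∫ w'²`, and Hardy's
inequality bounds the remaining integral. The constant is not sharp; the bound serves only for
finiteness. -/
lemma weighted_le (hw : IsProfile w) {p : ℝ} (hp : 2 < p) :
    ∫ t in Set.Ioi (0:ℝ), |w t| ^ p * t ^ (-(p / 2 + 1)) ≤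
      4 * (∫ t in Set.Ioi (0:ℝ), deriv w t ^ 2) ^ (p / 2) := by
  set F := ∫ t in Set.Ioi (0:ℝ), deriv w t ^ 2 with hF
  have hF0 : 0 ≤ F := integral_nonneg fun t => sq_nonneg _
  have hi1 : IntegrableOn (fun t => w t ^ 2 / t ^ 2) (Set.Ioi 0) := by
    refine hw.integrableOn_comp (F := fun t x => x ^ 2 / t ^ 2) (by simp) ?_
    refine ContinuousOn.div (by fun_prop) (by fun_prop) fun p hp => ?_
    have : 0 < p.1 := hp.1
    positivity
  have hpt : ∀ t ∈ Set.Ioi (0:ℝ), |w t| ^ p * t ^ (-(p / 2 + 1)) ≤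
      F ^ (p / 2 - 1) * (w t ^ 2 / t ^ 2) := by
    intro t ht
    have ht0 : 0 < t := ht
    have h1 := sq_intervalIntegral_le hw.memLp_deriv ht0.le
    rw [hw.intervalIntegral_deriv] at h1
    have h2 : |w t| ^ p = w t ^ 2 * (w t ^ 2) ^ (p / 2 - 1) := by
      rcases eq_or_ne (w t) 0 with h | h
      · simp [h, Real.zero_rpow (show p ≠ 0 by linarith)]
      · rw [← sq_abs, ← Real.rpow_natCast, ← Real.rpow_mul (abs_nonneg _),
          ← Real.rpow_add (abs_pos.2 h)]
        congr 1; push_cast; ring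
    have h3 : (w t ^ 2) ^ (p / 2 - 1) ≤ t ^ (p / 2 - 1) * F ^ (p / 2 - 1) := by
      rw [← Real.mul_rpow ht0.le hF0]
      exact Real.rpow_le_rpow (sq_nonneg _) h1 (by linarith)
    have h4 : t ^ (p / 2 - 1) * t ^ (-(p / 2 + 1)) = 1 / t ^ 2 := by
      rw [← Real.rpow_add ht0, show p / 2 - 1 + -(p / 2 + 1) = -((2:ℕ):ℝ) by push_cast; ring,
        Real.rpow_neg ht0.le, Real.rpow_natCast, one_div]
    calc |w t| ^ p * t ^ (-(p / 2 + 1))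
        ≤ w t ^ 2 * (t ^ (p / 2 - 1) * F ^ (p / 2 - 1)) * t ^ (-(p / 2 + 1)) := by
          rw [h2]; gcongr
      _ = F ^ (p / 2 - 1) * w t ^ 2 * (t ^ (p / 2 - 1) * t ^ (-(p / 2 + 1))) := by ring
      _ = F ^ (p / 2 - 1) * (w t ^ 2 / t ^ 2) := by rw [h4]; ring
  refine (setIntegral_mono_on (hw.integrableOn_weight (by linarith) _)
    (hi1.const_mul _) measurableSet_Ioi hpt).trans ?_
  rw [integral_const_mul]
  have hh := hw.hardy
  calc F ^ (p / 2 - 1) * ∫ t in Set.Ioi (0:ℝ), w t ^ 2 / t ^ 2 ≤ F ^ (p / 2 - 1) * (4 * F) := by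
        gcongr
    _ = 4 * F ^ (p / 2) := by
        rcases hF0.eq_or_lt with h | h
        · rw [← h, Real.zero_rpow (show p / 2 ≠ 0 by linarith)]; simp
        · rw [Real.rpow_sub_one h.ne']; field_simp

end IsProfile

/-- A weighted inequality for profiles extends to all primitives of `L²` functions. -/
lemma lintegral_weight_le_of_profile {p q C : ℝ} (hp : 0 < p)
    (hC : ∀ w, IsProfile w → ∫ t in Set.Ioi (0:ℝ), |w t| ^ p * t ^ q ≤
      C * (∫ t in Set.Ioi (0:ℝ), deriv w t ^ 2) ^ (p / 2))
    {f : ℝ → ℝ} (hf : MemLp f 2 (volume.restrict (Set.Ioi (0:ℝ)))) :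
    ∫⁻ t in Set.Ioi (0:ℝ), ENNReal.ofReal (|∫ s in (0:ℝ)..t, f s| ^ p * t ^ q) ≤
      ENNReal.ofReal (C * (∫ t in Set.Ioi (0:ℝ), f t ^ 2) ^ (p / 2)) := by
  obtain ⟨w, hw, hlim⟩ := exists_profile_tendsto hf
  have hsq : Tendsto (fun n => ∫ t in Set.Ioi (0:ℝ), deriv (w n) t ^ 2) atTop
      (𝓝 (∫ t in Set.Ioi (0:ℝ), f t ^ 2)) := by
    have h1 := (Lp.tendsto_Lp_iff_tendsto_eLpNorm'' (fun n => deriv (w n))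
      (fun n => (hw n).memLp_deriv) f hf).2 hlim
    have h2 := h1.inner (𝕜 := ℝ) h1
    simp_rw [inner_toLp] at h2
    simpa [sq] using h2
  have hdiff : Tendsto (fun n => ∫ t in Set.Ioi (0:ℝ), (deriv (w n) t - f t) ^ 2) atTop (𝓝 0) := by
    have h1 := (Lp.tendsto_Lp_iff_tendsto_eLpNorm'' (fun n => deriv (w n))
      (fun n => (hw n).memLp_deriv) f hf).2 hlim
    have h3 := h1.sub_const (hf.toLp f)
    rw [sub_self] at h3
    have h2 := h3.inner (𝕜 := ℝ) h3
    simp_rw [← MemLp.toLp_sub, inner_toLp] at h2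
    simpa [sq] using h2
  have hpt : ∀ t ∈ Set.Ioi (0:ℝ), Tendsto (fun n => w n t) atTop (𝓝 (∫ s in (0:ℝ)..t, f s)) := by
    intro t ht
    have ht0 : 0 < t := ht
    rw [tendsto_iff_dist_tendsto_zero]
    have h1 := hdiff.const_mul t
    rw [mul_zero] at h1
    have h2 := h1.sqrt
    rw [Real.sqrt_zero] at h2
    refine squeeze_zero (fun _ => dist_nonneg) (fun n => ?_) h2
    rw [Real.dist_eq, ← (hw n).intervalIntegral_deriv,
      ← intervalIntegral.integral_sub ((hw n).continuous_deriv.intervalIntegrable _ _)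
        (intervalIntegrable_of_memLp hf ht0.le)]
    exact Real.abs_le_sqrt (sq_intervalIntegral_le ((hw n).memLp_deriv.sub hf) ht0.le)
  have hB : Tendsto (fun n => ENNReal.ofReal
      (C * (∫ t in Set.Ioi (0:ℝ), deriv (w n) t ^ 2) ^ (p / 2))) atTop
      (𝓝 (ENNReal.ofReal (C * (∫ t in Set.Ioi (0:ℝ), f t ^ 2) ^ (p / 2)))) :=
    ENNReal.tendsto_ofReal ((hsq.rpow_const (Or.inr (by positivity))).const_mul C)
  calc ∫⁻ t in Set.Ioi (0:ℝ), ENNReal.ofReal (|∫ s in (0:ℝ)..t, f s| ^ p * t ^ q)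
      = ∫⁻ t in Set.Ioi (0:ℝ), liminf (fun n => ENNReal.ofReal (|w n t| ^ p * t ^ q)) atTop := by
        refine setLIntegral_congr_fun measurableSet_Ioi fun t ht => ?_
        refine (Tendsto.liminf_eq ?_).symm
        exact ENNReal.tendsto_ofReal
          (((hpt t ht).abs.rpow_const (Or.inr hp.le)).mul_const _)
    -- Fatou's lemma; working with lower integrals also makes integrability of the limit a
    -- conclusion.
    _ ≤ liminf (fun n => ∫⁻ t in Set.Ioi (0:ℝ), ENNReal.ofReal (|w n t| ^ p * t ^ q)) atTop := by
        refine lintegral_liminf_le' fun n => ?_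
        exact ((hw n).integrableOn_weight hp q).aestronglyMeasurable.aemeasurable.ennreal_ofReal
    _ ≤ liminf (fun n => ENNReal.ofReal
          (C * (∫ t in Set.Ioi (0:ℝ), deriv (w n) t ^ 2) ^ (p / 2))) atTop := by
        refine liminf_le_liminf (Eventually.of_forall fun n => ?_)
        rw [← ofReal_integral_eq_lintegral_ofReal ((hw n).integrableOn_weight hp q)]
        · exact ENNReal.ofReal_le_ofReal (hC _ (hw n))
        · filter_upwards [ae_restrict_mem measurableSet_Ioi] with t ht
          have ht0 : 0 < t := ht
          positivity
    _ = ENNReal.ofReal (C * (∫ t in Set.Ioi (0:ℝ), f t ^ 2) ^ (p / 2)) := hB.liminf_eq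

lemma tent_eq_one {a b r t : ℝ} {n : ℕ} (h1 : a + r ≤ t) (h2 : t ≤ b - r)
    (hn : 2 ≤ ((n : ℝ) + 1) * r) : tent a b n t = 1 := by
  have hn1 : (0:ℝ) < (n:ℝ) + 1 := by positivity
  unfold tent
  rw [min_eq_left (le_min ?_ ?_), max_eq_right zero_le_one]
  · have : ((n : ℝ) + 1) * r ≤ ((n : ℝ) + 1) * (t - a) :=
      mul_le_mul_of_nonneg_left (by linarith) hn1.le
    linarith
  · have : ((n : ℝ) + 1) * r ≤ ((n : ℝ) + 1) * (b - t) :=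
      mul_le_mul_of_nonneg_left (by linarith) hn1.le
    linarith

/-! ### Finite-energy functions of `Γ` have square integrable profiles. -/

namespace IsGreen

variable {N : ℕ} {Ω : Set (E N)} {e : E N} {Γ : E N → ℝ} {κ : ℝ}

lemma ae_energy (hG : IsGreen Ω e Γ κ) (hN : 0 < N) {P : E N → Prop} :
    (∀ᵐ z ∂(energy Ω e Γ), P z) ↔ ∀ᵐ z ∂(volume.restrict Ω), P z := by
  rw [← restrict_sdiff_singleton (Ω := Ω) (e := e) hN]
  exact ⟨fun h => hG.ac_energy h, fun h => energy_ac h⟩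

lemma integrable_mul_energy (hG : IsGreen Ω e Γ κ) {u : E N → ℝ}
    (hu : LocallyIntegrableOn u Ω) {a b : ℝ} (ha : 0 < a) {h : ℝ → ℝ} (hh : Continuous h)
    (h0 : ∀ t ≤ a, h t = 0) (h1 : ∀ t, b ≤ t → h t = 0) :
    Integrable (fun z => h (Γ z) * u z) (energy Ω e Γ) := by
  have hp := hG.comp_props ha h0 h1 (n := 0) (contDiff_zero.2 hh)
  rw [hG.integrable_energy_iff]
  have hli : LocallyIntegrableOn (fun z => ‖gradient Γ z‖ ^ 2 * u z) (Ω \ {e}) :=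
    (hu.mono_set Set.sdiff_subset).continuousOn_mul (hG.continuousOn_gradient.norm.pow 2)
      hG.isOpen_diff.isLocallyClosed
  refine (integrable_smul_of_tsupport_subset hp.1.continuous hp.2.1 hp.2.2 hli).restrict.congr ?_
  refine Eventually.of_forall fun z => ?_
  simp only [Function.comp_apply, smul_eq_mul]
  ring

/-- Since `h(Γ)` vanishes near the pole and near the boundary, `h(Γ) |∇Γ|²` is continuous with
compact support in `Ω`, so local `L¹` convergence is enough. -/
lemma tendsto_integral_energy (hG : IsGreen Ω e Γ κ) {u : E N → ℝ} {φ : ℕ → E N → ℝ}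
    (hφ : ∀ n, IsTest Ω (φ n)) (hu : LocallyIntegrableOn u Ω)
    (hlim : ∀ K : Set (E N), IsCompact K → K ⊆ Ω →
      Tendsto (fun n => ∫⁻ z in K, ‖φ n z - u z‖ₑ) atTop (𝓝 0))
    {a b : ℝ} (ha : 0 < a) {h : ℝ → ℝ} (hh : Continuous h)
    (h0 : ∀ t ≤ a, h t = 0) (h1 : ∀ t, b ≤ t → h t = 0) :
    Tendsto (fun n => ∫ z, h (Γ z) * φ n z ∂(energy Ω e Γ)) atTop
      (𝓝 (∫ z, h (Γ z) * u z ∂(energy Ω e Γ))) := by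
  have hp := hG.comp_props ha h0 h1 (n := 0) (contDiff_zero.2 hh)
  set η : E N → ℝ := fun z => h (Γ z) * ‖gradient Γ z‖ ^ 2 with hη
  have hts : tsupport η ⊆ tsupport (h ∘ Γ) := tsupport_mul_subset_left
  have hηc : HasCompactSupport η := hp.2.1.mul_right
  have hηcont : Continuous η := by
    refine continuous_of_tsupport fun z hz => ?_
    have hz' := hp.2.2 (hts hz)
    exact hp.1.continuous.continuousAt.mul
      ((hG.continuousOn_gradient.continuousAt (hG.isOpen_diff.mem_nhds hz')).norm.pow 2)
  have key : ∀ F : E N → ℝ, ∫ z, h (Γ z) * F z ∂(energy Ω e Γ) = ∫ z, η z * F z := by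
    intro F
    rw [hG.integral_energy, ← setIntegral_eq_integral_of_forall_compl_eq_zero (s := Ω \ {e})
      (f := fun z => η z * F z)]
    · refine integral_congr_ae (Eventually.of_forall fun z => ?_)
      simp only [hη]; ring
    · intro z hz
      rw [image_eq_zero_of_notMem_tsupport (fun h' => hz (hp.2.2 (hts h'))), zero_mul]
  simp_rw [key]
  exact tendsto_integral_mul_of_lintegral
    (fun n => (hφ n).1.continuous.locallyIntegrable.locallyIntegrableOn _) hu hlim hηcont hηc
    (hts.trans (hp.2.2.trans Set.sdiff_subset))

lemma aemeasurable_of_ae_eq (hG : IsGreen Ω e Γ κ) (hN : 0 < N) {u : E N → ℝ}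
    (hu : LocallyIntegrableOn u Ω) {v : ℝ → ℝ} (hv : ∀ᵐ z ∂(volume.restrict Ω), u z = v (Γ z)) :
    AEMeasurable v (volume.restrict (Set.Ioi (0:ℝ))) := by
  have hvE : u =ᵐ[energy Ω e Γ] v ∘ Γ := (hG.ae_energy hN).2 hv
  have hUm : energy Ω e Γ (Ω \ {e})ᶜ = 0 := by
    refine energy_ac ?_
    rw [Measure.restrict_apply hG.isOpen_diff.measurableSet.compl, Set.compl_inter_self,
      measure_empty]
  have huE : AEMeasurable u (energy Ω e Γ) := by
    refine AEMeasurable.mono_ac ?_ energy_ac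
    rw [restrict_sdiff_singleton hN]
    exact hu.aestronglyMeasurable.aemeasurable
  have h1 := aemeasurable_of_comp hG.isOpen_diff.measurableSet hUm hG.continuousOn
    (huE.congr hvE)
  rw [hG.map_energy hN] at h1
  exact h1.mono_ac (Measure.absolutelyContinuous_smul (by simpa using hG.const_pos))

lemma integral_mul_of_ae_eq (hG : IsGreen Ω e Γ κ) (hN : 0 < N) {u : E N → ℝ}
    (hu : LocallyIntegrableOn u Ω) {v : ℝ → ℝ} (hv : ∀ᵐ z ∂(volume.restrict Ω), u z = v (Γ z))
    {a b : ℝ} {h : ℝ → ℝ} (ha : 0 < a) (hh : Continuous h) (h0 : ∀ t ≤ a, h t = 0)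
    (h1 : ∀ t, b ≤ t → h t = 0) : IntegrableOn (fun t => h t * v t) (Set.Ioi 0) ∧
      ∫ z, h (Γ z) * u z ∂(energy Ω e Γ) = κ * ∫ t in Set.Ioi (0:ℝ), h t * v t := by
  have hm : AEStronglyMeasurable (fun t => h t * v t) (volume.restrict (Set.Ioi (0:ℝ))) :=
    (hh.aemeasurable.mul (hG.aemeasurable_of_ae_eq hN hu hv)).aestronglyMeasurable
  have hae : (fun z => h (Γ z) * u z) =ᵐ[energy Ω e Γ] fun z => h (Γ z) * v (Γ z) := by
    filter_upwards [(hG.ae_energy hN).2 hv] with z hz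
    rw [hz]
  refine ⟨?_, ?_⟩
  · rw [← hG.integrable_comp hN hm]
    exact (hG.integrable_mul_energy hu ha hh h0 h1).congr hae
  · rw [integral_congr_ae hae, hG.integral_comp hN hm]

lemma locallyIntegrableOn_of_ae_eq (hG : IsGreen Ω e Γ κ) (hN : 0 < N) {u : E N → ℝ}
    (hu : LocallyIntegrableOn u Ω) {v : ℝ → ℝ} (hv : ∀ᵐ z ∂(volume.restrict Ω), u z = v (Γ z)) :
    LocallyIntegrableOn v (Set.Ioi 0) := by
  intro t ht
  have ht0 : 0 < t := ht
  -- Large enough for the tent on `(t/4, 2t)` to equal `1` on `(t/2, 3t/2)`.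
  obtain ⟨n, hn⟩ := exists_nat_gt (8 / t)
  have hmul : 2 ≤ ((n : ℝ) + 1) * (t / 4) := by
    rw [div_lt_iff₀ ht0] at hn
    nlinarith
  have hI := (hG.integral_mul_of_ae_eq hN hu hv
    (a := t / 4 + 1 / ((n : ℝ) + 1)) (b := 2 * t) (by positivity)
    (continuous_tent (t / 4) (2 * t) n) (fun s hs => tent_eq_zero_left hs)
    (fun s hs => tent_eq_zero_right hs)).1
  refine ⟨Set.Ioo (t / 2) (3 / 2 * t), mem_nhdsWithin_of_mem_nhds
    (Ioo_mem_nhds (by linarith) (by linarith)), ?_⟩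
  refine (hI.mono_set fun s hs => (by linarith [hs.1] : 0 < s)).congr_fun (fun s hs => ?_)
    measurableSet_Ioo
  have h1 : tent (t / 4) (2 * t) n s = 1 :=
    tent_eq_one (r := t / 4) (by linarith [hs.1]) (by linarith [hs.2]) hmul
  simp [h1]

/-- A function of finite energy that depends only on `Γ` has a square integrable profile `f`
whose primitive represents it, with energy controlled by that of the function. -/
theorem exists_profile (hG : IsGreen Ω e Γ κ) (hN : 0 < N) {u : E N → ℝ} {g : E N → E N}
    (hu : MemHomSobolevZero 2 Ω u) (hg : IsWeakGradient Ω u g) {v : ℝ → ℝ}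
    (hv : ∀ᵐ z ∂(volume.restrict Ω), u z = v (Γ z)) :
    ∃ f : ℝ → ℝ, MemLp f 2 (volume.restrict (Set.Ioi (0:ℝ))) ∧
      κ * ∫ t in Set.Ioi (0:ℝ), f t ^ 2 ≤ ∫ z in Ω, ‖g z‖ ^ 2 ∧
      ∀ᵐ z ∂(volume.restrict Ω), u z = ∫ s in (0:ℝ)..Γ z, f s := by
  obtain ⟨g', φ, hg', hφ, hφu, hφg⟩ := hu
  have hgg : g' =ᵐ[volume.restrict Ω] g := hg'.ae_eq hG.isOpen hg
  have hgL' : MemLp g' 2 (volume.restrict Ω) :=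
    memLp_of_tendsto (hg'.2.1.aestronglyMeasurable) hφ hφg
  have hgLU : MemLp g' 2 (volume.restrict (Ω \ {e})) := by
    rwa [restrict_sdiff_singleton hN]
  obtain ⟨f, hf, hfle, hfid⟩ := hG.exists_average hN hgLU
  refine ⟨f, hf, ?_, ?_⟩
  · rw [restrict_sdiff_singleton hN] at hfle
    refine hfle.trans (le_of_eq (integral_congr_ae ?_))
    filter_upwards [hgg] with z hz
    rw [hz]
  have hvh := fun {a b : ℝ} {h : ℝ → ℝ} => hG.integral_mul_of_ae_eq (a := a) (b := b) (h := h)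
    hN hg.1 hv
  have hvloc := hG.locallyIntegrableOn_of_ae_eq hN hg.1 hv
  have hprim := continuousOn_prim hf
  have key := isOpen_Ioi.ae_eq_zero_of_integral_contDiff_smul_eq_zero (μ := volume)
    (f := fun t => v t - ∫ s in (0:ℝ)..t, f s) (U := Set.Ioi (0:ℝ))
    (hvloc.sub (hprim.locallyIntegrableOn measurableSet_Ioi)) (fun h hh hhc hhs => ?_)
  · have h2 : ∀ᵐ t ∂(volume.restrict (Set.Ioi (0:ℝ))), v t = ∫ s in (0:ℝ)..t, f s := by
      rw [ae_restrict_iff' measurableSet_Ioi]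
      filter_upwards [key] with t ht ht0 using sub_eq_zero.1 (ht ht0)
    have h3 : ∀ᵐ z ∂(energy Ω e Γ), v (Γ z) = ∫ s in (0:ℝ)..Γ z, f s := by
      refine ae_of_ae_map (p := fun t => v t = ∫ s in (0:ℝ)..t, f s) hG.aemeasurable ?_
      rw [hG.map_energy hN]
      exact Measure.ae_smul_measure h2 _
    filter_upwards [hv, (hG.ae_energy hN).1 h3] with z h4 h5
    rw [h4, h5]
  · obtain ⟨a, ha, b, hab, h0, h1⟩ := exists_bounds hhc hhs
    have hcont := hh.continuous
    -- The primitive of `h` that vanishes at infinity, so that the pole does not contribute. It need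
    -- not vanish at `0`: the approximating test functions do so near the boundary, and this is what
    -- selects the primitive of `f` starting at `0`.
    set H : ℝ → ℝ := fun t => ∫ s in b..t, h s with hH
    have hHd : ∀ t, HasDerivAt H (h t) t := fun t =>
      (hcont.integral_hasStrictDerivAt b t).hasDerivAt
    have hHc : Continuous H := continuous_iff_continuousAt.2 fun t => (hHd t).continuousAt
    have hH1 : ∀ t, b ≤ t → H t = 0 := fun t ht =>
      intervalIntegral.integral_zero_ae (f := h) (Eventually.of_forall fun x hx => h1 x
        (by rw [Set.uIoc_of_le ht] at hx; exact hx.1.le))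
    have hH0 : ∀ t ≤ a, H t = H a := by
      intro t ht
      rw [hH, ← sub_eq_zero]
      dsimp only
      rw [intervalIntegral.integral_interval_sub_left (hcont.intervalIntegrable _ _)
        (hcont.intervalIntegrable _ _)]
      exact intervalIntegral.integral_zero_ae (f := h) (Eventually.of_forall fun x hx => h0 x
        (by rw [Set.uIoc_of_ge ht] at hx; exact hx.2))
    have hHL : MemLp H 2 (volume.restrict (Set.Ioi (0:ℝ))) := by
      have h2 : MemLp H 2 (volume.restrict (Set.Icc 0 b)) := by
        obtain ⟨M, hM⟩ := (isCompact_Icc (a := (0:ℝ)) (b := b)).exists_bound_of_continuousOn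
          hHc.continuousOn
        exact MemLp.of_bound hHc.aestronglyMeasurable M
          (by filter_upwards [ae_restrict_mem measurableSet_Icc] with t ht using hM t ht)
      rw [← memLp_indicator_iff_restrict measurableSet_Icc] at h2
      refine (h2.restrict (Set.Ioi 0)).ae_eq ?_
      filter_upwards [ae_restrict_mem measurableSet_Ioi] with t ht
      by_cases htb : t ≤ b
      · rw [Set.indicator_of_mem (Set.mem_Icc.2 ⟨le_of_lt ht, htb⟩)]
      · rw [Set.indicator_of_notMem (fun h' => htb h'.2), hH1 t (not_le.1 htb).le]
    have hYL := hG.memLp_smul_gradient hN hHc.measurable hHL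
    have l1 : Tendsto (fun n => ∫ z in Ω \ {e},
        inner ℝ (gradient (φ n) z) (H (Γ z) • gradient Γ z)) atTop
        (𝓝 (∫ z in Ω \ {e}, inner ℝ (g' z) (H (Γ z) • gradient Γ z))) := by
      refine tendsto_integral_inner (fun n => ((hφ n).memLp_gradient 2).restrict _) hgLU hYL ?_
      rwa [restrict_sdiff_singleton hN]
    have l2 := (hG.tendsto_integral_energy hφ hg.1 hφu ha hcont h0 h1).neg
    -- The same limit is computed from convergence of the gradients and from local convergence of
    -- the functions. Averaging and integration by parts then give `∫ h v = ∫ h ∫_0^t f`.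
    have l3 := tendsto_nhds_unique (l1.congr fun n =>
      hG.integral_inner_gradient hN (hφ n) ha hHd hcont hH0 hH1 h0 h1 hYL) l2
    obtain ⟨hvi, hve⟩ := hvh ha hcont h0 h1
    rw [hfid H hHc.measurable hHL, hve, integral_mul_primitive hf hcont (ha.le.trans hab) h1,
      mul_neg, neg_inj] at l3
    have l4 := mul_left_cancel₀ hG.const_pos.ne' l3
    have hpi : IntegrableOn (fun t => h t * ∫ s in (0:ℝ)..t, f s) (Set.Ioi 0) := by
      have h2 : IntegrableOn (fun t => h t * ∫ s in (0:ℝ)..t, f s) (Set.Icc a b) :=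
        (hcont.continuousOn.mul
          (hprim.mono fun t ht => ha.trans_le ht.1)).integrableOn_Icc
      rw [integrableOn_iff_integrable_of_support_subset] at h2
      · exact h2.integrableOn
      · intro t ht
        refine ⟨le_of_lt (not_le.1 fun h' => ht ?_), le_of_lt (not_le.1 fun h' => ht ?_)⟩
        · simp [h0 t h']
        · simp [h1 t h']
    rw [← setIntegral_eq_integral_of_forall_compl_eq_zero (s := Set.Ioi (0:ℝ))
      (fun x hx => by simp [h0 x ((not_lt.1 hx).trans ha.le)])]
    simp only [smul_eq_mul, mul_sub]
    rw [integral_sub hvi hpi, l4, sub_self]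

end IsGreen

/-! ### The Newton kernel as a Green function of the whole space. -/

/-- The Newton kernel with pole `a`. -/
noncomputable def newton (N : ℕ) (a z : E N) : ℝ := ‖z - a‖ ^ (-((N : ℝ) - 2))

section newton

variable {N : ℕ} {a z : E N}

/-- A default value: a real power of `0` with nonzero exponent is `0`, even when the exponent is
negative. This matches `IsGreen.zero_pole`. -/
lemma newton_self (hN : 2 < N) : newton N a a = 0 := by
  have : (2:ℝ) < N := by exact_mod_cast hN
  rw [newton, sub_self, norm_zero, Real.zero_rpow (by linarith)]

lemma newton_pos (hz : z ≠ a) : 0 < newton N a z :=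
  Real.rpow_pos_of_pos (norm_pos_iff.2 (sub_ne_zero.2 hz)) _

lemma contDiffAt_newton (hz : z ≠ a) : ContDiffAt ℝ ∞ (newton N a) z := by
  have h := sub_ne_zero.2 hz
  exact ((contDiffAt_id.sub contDiffAt_const).norm ℝ h).rpow_const_of_ne (norm_ne_zero_iff.2 h)

lemma hasGradientAt_newton (hz : z ≠ a) : HasGradientAt (newton N a)
    ((-((N : ℝ) - 2)) • (‖z - a‖ ^ N)⁻¹ • (z - a)) z := by
  have h : 0 < ‖z - a‖ := norm_pos_iff.2 (sub_ne_zero.2 hz)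
  have h1 : HasFDerivAt (fun y : E N => ‖y - a‖ ^ 2) (2 • (innerSL ℝ (z - a))) z := by
    have := ((hasFDerivAt_id (𝕜 := ℝ) z).sub_const a).norm_sq
    simpa using this
  have h2 := h1.rpow_const (p := -((N : ℝ) - 2) / 2) (Or.inl (by positivity))
  have h3 : newton N a = fun y => (‖y - a‖ ^ 2) ^ (-((N : ℝ) - 2) / 2) := by
    ext y
    rw [newton, ← Real.rpow_natCast, ← Real.rpow_mul (norm_nonneg _)]
    congr 1; push_cast; ring
  rw [h3, hasGradientAt_iff_hasFDerivAt]
  refine h2.congr_fderiv ?_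
  ext y
  have h4 : (‖z - a‖ ^ 2) ^ (-((N : ℝ) - 2) / 2 - 1) = (‖z - a‖ ^ N)⁻¹ := by
    rw [← Real.rpow_natCast, ← Real.rpow_mul (norm_nonneg _), ← Real.rpow_natCast _ N,
      ← Real.rpow_neg (norm_nonneg _)]
    congr 1; push_cast; ring
  simp only [h4, smul_apply, innerSL_apply_apply,
    InnerProductSpace.toDual_apply_apply, inner_smul_left, smul_eq_mul, nsmul_eq_mul]
  simp
  ring

lemma gradient_newton (hz : z ≠ a) : gradient (newton N a) z =
    (-((N : ℝ) - 2)) • (‖z - a‖ ^ N)⁻¹ • (z - a) := (hasGradientAt_newton hz).gradient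

lemma norm_gradient_newton_sq (hz : z ≠ a) : ‖gradient (newton N a) z‖ ^ 2 =
    ((N : ℝ) - 2) ^ 2 * ‖z - a‖ ^ (-2 * ((N : ℝ) - 1)) := by
  have h : 0 < ‖z - a‖ := norm_pos_iff.2 (sub_ne_zero.2 hz)
  rw [gradient_newton hz, norm_smul, norm_smul, mul_pow, norm_neg, Real.norm_eq_abs, sq_abs,
    norm_inv, norm_pow, norm_norm]
  congr 1
  rw [← Real.rpow_natCast _ N, ← Real.rpow_neg h.le, ← Real.rpow_add_one h.ne', ← Real.rpow_natCast,
    ← Real.rpow_mul h.le]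
  congr 1; push_cast; ring

lemma integrable_inner_of_tsupport_subset {U : Set (E N)} (hU : IsOpen U) {G f : E N → E N}
    (hG : Continuous G) (hc : HasCompactSupport G) (hs : tsupport G ⊆ U) (hf : ContinuousOn f U) :
    Integrable (fun z => inner ℝ (G z) (f z)) := by
  have hss : Function.support (fun z => inner ℝ (G z) (f z)) ⊆ Function.support G := by
    intro z hz h
    exact hz (by simp [h])
  have hts := closure_mono hss
  refine Continuous.integrable_of_hasCompactSupport ?_ (hc.mono hss)
  refine continuous_of_tsupport fun z hz => ?_
  exact hG.continuousAt.inner (hf.continuousAt (hU.mem_nhds (hs (hts hz))))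

lemma continuousOn_gradient_newton : ContinuousOn (gradient (newton N a)) {a}ᶜ := by
  intro z hz
  have h := ((contDiffAt_newton (N := N) hz).fderiv_right (m := 0) (by simp)).continuousAt
  have : ContinuousAt (gradient (newton N a)) z := by
    unfold gradient
    exact (LinearIsometryEquiv.continuous _).continuousAt.comp h
  exact this.continuousWithinAt

lemma tsupport_gradient_subset_compl {ψ : E N → ℝ} (h : ∀ᶠ z in 𝓝 a, ψ z = ψ a) :
    tsupport (gradient ψ) ⊆ {a}ᶜ := by
  intro z hz
  rintro rfl
  refine (notMem_tsupport_iff_eventuallyEq.2 ?_) hz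
  have h1 : ψ =ᶠ[𝓝 z] fun _ => ψ z := h
  refine h1.gradient.trans (Eventually.of_forall fun y => ?_)
  simp

lemma integrable_inner_gradient_newton {ψ : E N → ℝ} (hψ : ContDiff ℝ 1 ψ)
    (hc : HasCompactSupport ψ) (h : ∀ᶠ z in 𝓝 a, ψ z = ψ a) :
    Integrable (fun z => inner ℝ (gradient ψ z) (gradient (newton N a) z)) :=
  integrable_inner_of_tsupport_subset isOpen_compl_singleton (continuous_gradient hψ)
    (hasCompactSupport_gradient hc) (tsupport_gradient_subset_compl h) continuousOn_gradient_newton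

/-- The Newton kernel is a multiple of the fundamental solution of `-Δ`. -/
lemma integral_inner_gradient_newton_eq (hN : 0 < N) {ψ : E N → ℝ} (hψ : ContDiff ℝ 1 ψ)
    (hc : HasCompactSupport ψ) (h : ∀ᶠ z in 𝓝 a, ψ z = ψ a) :
    ∫ z, inner ℝ (gradient ψ z) (gradient (newton N a) z) =
      ((N : ℝ) - 2) * sphereArea N * ψ a := by
  set χ : E N → ℝ := fun z => ψ (z + a) with hχ
  have hχ1 : ContDiff ℝ 1 χ := hψ.comp (contDiff_id.add contDiff_const)
  have hχc : HasCompactSupport χ := hc.comp_homeomorph (Homeomorph.addRight a)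
  have hχg : ∀ z, gradient χ z = gradient ψ (z + a) := by
    intro z
    simp only [gradient, hχ]
    rw [fderiv_comp_add_right]
  have e1 : ∀ z, inner ℝ (gradient ψ (z + a)) (gradient (newton N a) (z + a)) =
      (-((N : ℝ) - 2)) * inner ℝ (gradient χ z) ((‖z‖ ^ N)⁻¹ • z) := by
    intro z
    -- At the pole `ψ` is locally constant, so its gradient annihilates whatever the singular factor
    -- is there.
    by_cases hz : z = 0
    · have : gradient ψ a = 0 := by
        by_contra h'
        exact tsupport_gradient_subset_compl h (subset_tsupport _ h') rfl
      simp [hz, this]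
    · rw [gradient_newton (by simpa using hz), hχg, inner_smul_right]
      simp
  have hI := (integrable_inner_gradient_newton hψ hc h).comp_add_right a
  simp_rw [e1] at hI
  rw [← integral_add_right_eq_self _ a]
  simp_rw [e1]
  rw [integral_const_mul]
  by_cases h2 : (N : ℝ) - 2 = 0
  · simp [h2]
  · rw [integral_inner_gradient_newton hN hχ1 hχc]
    · simp only [hχ, zero_add]; ring
    · have := hI.const_mul (-((N : ℝ) - 2))⁻¹
      refine this.congr (Eventually.of_forall fun z => ?_)
      simp only
      rw [← mul_assoc, inv_mul_cancel₀ (neg_ne_zero.2 h2), one_mul]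

lemma exists_isCompact_newton (hN : 2 < N) {c : ℝ} (hc : 0 < c) :
    ∃ K, IsCompact K ∧ {z | c ≤ newton N a z} ⊆ K := by
  have hN' : (2:ℝ) < N := by exact_mod_cast hN
  have h1 : Tendsto (newton N a) (cocompact (E N)) (𝓝 0) := by
    refine (tendsto_rpow_neg_atTop (show 0 < (N : ℝ) - 2 by linarith)).comp ?_
    exact (tendsto_norm_cocompact_atTop).comp
      (Homeomorph.addRight (-a)).isClosedEmbedding.tendsto_cocompact
  obtain ⟨K, hK, hKs⟩ := mem_cocompact.1 (h1.eventually_lt_const hc)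
  refine ⟨K, hK, fun z hz => ?_⟩
  by_contra h
  have h2 : newton N a z < c := hKs h
  exact absurd h2 (not_lt.2 hz)

lemma tendsto_newton (hN : 2 < N) : Tendsto (newton N a) (𝓝[≠] a) atTop := by
  have hN' : (2:ℝ) < N := by exact_mod_cast hN
  refine (tendsto_rpow_neg_nhdsGT_zero (show -((N : ℝ) - 2) < 0 by linarith)).comp ?_
  exact tendsto_norm_sub_self_nhdsNE a

lemma sphereArea_pos (hN : 0 < N) : 0 < sphereArea N := by
  have : Nonempty (Fin N) := ⟨⟨0, hN⟩⟩
  rw [sphereArea, ENNReal.toReal_pos_iff]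
  refine ⟨?_, measure_lt_top _ _⟩
  rw [pos_iff_ne_zero, Ne, Measure.measure_univ_eq_zero]
  exact Measure.toSphere_ne_zero _

lemma isGreen_univ (hN : 2 < N) :
    IsGreen Set.univ 0 (newton N 0) (((N : ℝ) - 2) * sphereArea N) where
  isOpen := isOpen_univ
  mem := trivial
  const_pos := by
    have hN' : (2:ℝ) < N := by exact_mod_cast hN
    exact mul_pos (by linarith) (sphereArea_pos (by omega))
  zero_off := fun z hz => absurd trivial hz
  zero_pole := newton_self hN
  pos := fun z hz => newton_pos hz.2
  smooth := fun z hz => contDiffAt_newton hz.2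
  compact := fun c hc => by
    obtain ⟨K, hK, h⟩ := exists_isCompact_newton (N := N) (a := 0) hN hc
    exact ⟨K, hK, Set.subset_univ _, h⟩
  pole := tendsto_newton hN
  gradient_ne := fun z hz => by
    have hz' : z ≠ 0 := hz.2
    have hN' : (2:ℝ) < N := by exact_mod_cast hN
    rw [gradient_newton hz']
    have h2 : 2 - (N : ℝ) ≠ 0 := by linarith
    simp [hz', h2]
  green := fun ψ h1 h2 _ h4 => by
    rw [setIntegral_univ, integral_inner_gradient_newton_eq (by omega) h1 h2 h4]

end newton

/-! ### The Green function of the half-space by reflection. -/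

section halfSpace

variable {N : ℕ} [NeZero N]

lemma norm_add_sq_sub_norm_sub_sq (z : E N) :
    ‖z + eN N‖ ^ 2 - ‖z - eN N‖ ^ 2 = 4 * z (lastIdx N) := by
  rw [norm_add_sq_real, norm_sub_sq_real]
  have : inner ℝ z (eN N) = z (lastIdx N) := by
    simp [eN, EuclideanSpace.inner_single_right]
  rw [this]; ring

lemma mem_halfSpace_iff (z : E N) : z ∈ halfSpace N ↔ ‖z - eN N‖ < ‖z + eN N‖ := by
  rw [← pow_lt_pow_iff_left₀ (norm_nonneg _) (norm_nonneg _) two_ne_zero, ← sub_pos,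
    norm_add_sq_sub_norm_sub_sq]
  simp [halfSpace]

lemma isOpen_halfSpace : IsOpen (halfSpace N) := by
  have : Continuous fun z : E N => z (lastIdx N) := by fun_prop
  exact isOpen_lt continuous_const this

lemma norm_eN : ‖eN N‖ = 1 := by simp [eN]

lemma eN_mem_halfSpace : eN N ∈ halfSpace N := by
  simp [halfSpace, eN]

lemma neg_eN_notMem_halfSpace : -eN N ∉ halfSpace N := by
  simp [halfSpace, eN]

/-- The Green function of the half-space with pole `(0, 1)` up to normalisation, extended by `0`. -/
noncomputable def greenHalf (N : ℕ) [NeZero N] : E N → ℝ :=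
  (halfSpace N \ {eN N}).indicator fun z => newton N (eN N) z - newton N (-eN N) z

lemma greenHalf_eventuallyEq {z : E N} (hz : z ∈ halfSpace N \ {eN N}) :
    greenHalf N =ᶠ[𝓝 z] fun z => newton N (eN N) z - newton N (-eN N) z := by
  filter_upwards [(isOpen_halfSpace.sdiff isClosed_singleton).mem_nhds hz] with y hy
  exact Set.indicator_of_mem hy _

lemma ne_neg_eN {z : E N} (hz : z ∈ halfSpace N) : z ≠ -eN N := by
  rintro rfl
  exact neg_eN_notMem_halfSpace hz

lemma gradient_greenHalf {z : E N} (hz : z ∈ halfSpace N \ {eN N}) :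
    gradient (greenHalf N) z = gradient (newton N (eN N)) z - gradient (newton N (-eN N)) z := by
  rw [(greenHalf_eventuallyEq hz).gradient_eq]
  refine HasGradientAt.gradient ?_
  rw [hasGradientAt_iff_hasFDerivAt, map_sub]
  have h1 := (contDiffAt_newton (N := N) hz.2).differentiableAt (by simp)
  have h2 := (contDiffAt_newton (ne_neg_eN hz.1)).differentiableAt (by simp)
  exact h1.hasGradientAt.hasFDerivAt.sub h2.hasGradientAt.hasFDerivAt

/-- The gradients of the two kernels cannot cancel: their lengths are strictly decreasing in the
distance to the pole, and `e_N` is strictly closer than `-e_N`. -/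
lemma gradient_greenHalf_ne (hN : 2 < N) {z : E N} (hz : z ∈ halfSpace N \ {eN N}) :
    gradient (greenHalf N) z ≠ 0 := by
  have hN' : (2:ℝ) < N := by exact_mod_cast hN
  have h1 := (mem_halfSpace_iff z).1 hz.1
  have h0 : 0 < ‖z - eN N‖ := norm_pos_iff.2 (sub_ne_zero.2 hz.2)
  intro h
  rw [gradient_greenHalf hz, sub_eq_zero] at h
  have h2 := congrArg (fun y => ‖y‖ ^ 2) h
  rw [norm_gradient_newton_sq hz.2, norm_gradient_newton_sq (ne_neg_eN hz.1)] at h2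
  have h3 := mul_left_cancel₀ (by have : (N:ℝ) - 2 ≠ 0 := by linarith
                                  positivity) h2
  have h4 := Real.rpow_lt_rpow_of_neg h0 (by simpa using h1)
    (show -2 * ((N : ℝ) - 1) < 0 by linarith) (y := ‖z - -eN N‖)
  linarith

lemma exists_isCompact_greenHalf (hN : 2 < N) {c : ℝ} (hc : 0 < c) :
    ∃ K, IsCompact K ∧ K ⊆ halfSpace N ∧ {z | c ≤ greenHalf N z} ⊆ K := by
  have hN' : (2:ℝ) < N := by exact_mod_cast hN
  have hm : 0 < (N:ℝ) - 2 := by linarith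
  set m := (N:ℝ) - 2 with hm_def
  -- Clearing denominators in `c ≤ |z - e|^(-m) - |z + e|^(-m)` gives a closed condition that makes
  -- sense at the poles: it includes `e_N` and excludes `-e_N`.
  set K : Set (E N) := {z | ‖z - eN N‖ ^ m * (1 + c * ‖z + eN N‖ ^ m) ≤ ‖z + eN N‖ ^ m} with hK
  have hpos : ∀ z ∈ K, 0 < ‖z + eN N‖ := by
    intro z hz
    by_contra h
    have h0 : z + eN N = 0 := norm_eq_zero.1 (le_antisymm (not_lt.1 h) (norm_nonneg _))
    have h1 : z = -eN N := eq_neg_of_add_eq_zero_left h0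
    have h2 : ‖z - eN N‖ = 2 := by
      rw [h1, ← neg_add', norm_neg, ← two_smul ℝ, norm_smul, norm_eN]; norm_num
    have h3 : ‖z - eN N‖ ^ m * (1 + c * ‖z + eN N‖ ^ m) ≤ ‖z + eN N‖ ^ m := hz
    rw [h0, norm_zero, Real.zero_rpow hm.ne', h2] at h3
    have : (0:ℝ) < 2 ^ m := by positivity
    linarith
  have hclosed : IsClosed K := by
    have hcont : ∀ y : E N, Continuous fun z : E N => ‖z - y‖ ^ m := fun y =>
      (by fun_prop : Continuous fun z : E N => ‖z - y‖).rpow_const fun _ => Or.inr hm.le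
    have h1 := hcont (eN N)
    have h2 : Continuous fun z : E N => ‖z + eN N‖ ^ m := by simpa using hcont (-eN N)
    exact isClosed_le (h1.mul (continuous_const.add (continuous_const.mul h2))) h2
  obtain ⟨K0, hK0, hK0s⟩ := exists_isCompact_newton (N := N) (a := eN N) hN hc
  have hnewton : ∀ y z : E N, newton N y z = (‖z - y‖ ^ m)⁻¹ := fun y z => by
    rw [newton, Real.rpow_neg (norm_nonneg _)]
  refine ⟨K, ?_, ?_, ?_⟩
  · refine (hK0.insert (eN N)).of_isClosed_subset hclosed fun z hz => ?_
    by_cases h : z = eN N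
    · exact Or.inl h
    · refine Or.inr (hK0s ?_)
      have h1 : 0 < ‖z - eN N‖ := norm_pos_iff.2 (sub_ne_zero.2 h)
      have h2 := hpos z hz
      have h3 : ‖z - eN N‖ ^ m * (1 + c * ‖z + eN N‖ ^ m) ≤ ‖z + eN N‖ ^ m := hz
      change c ≤ newton N (eN N) z
      have h5 : 0 < ‖z - eN N‖ ^ m := by positivity
      have h6 : 0 < ‖z + eN N‖ ^ m := by positivity
      rw [hnewton, le_inv_comm₀ hc h5, ← one_div, le_div_iff₀ hc]
      have : (‖z - eN N‖ ^ m * c) * ‖z + eN N‖ ^ m ≤ 1 * ‖z + eN N‖ ^ m := by nlinarith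
      exact le_of_mul_le_mul_right this h6
  · intro z hz
    by_cases h : z = eN N
    · rw [h]; exact eN_mem_halfSpace
    rw [mem_halfSpace_iff]
    have h1 : 0 < ‖z - eN N‖ := norm_pos_iff.2 (sub_ne_zero.2 h)
    have h2 := hpos z hz
    have h3 : ‖z - eN N‖ ^ m * (1 + c * ‖z + eN N‖ ^ m) ≤ ‖z + eN N‖ ^ m := hz
    have h5 : 0 < ‖z - eN N‖ ^ m := by positivity
    have h6 : 0 < ‖z + eN N‖ ^ m := by positivity
    have h7 : 0 < ‖z - eN N‖ ^ m * (c * ‖z + eN N‖ ^ m) := by positivity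
    exact (Real.rpow_lt_rpow_iff h1.le h2.le hm).1 (by linarith)
  · intro z hz
    have hz' : c ≤ greenHalf N z := hz
    have hmem : z ∈ halfSpace N \ {eN N} := by
      by_contra h
      rw [greenHalf, Set.indicator_of_notMem h] at hz'
      linarith
    have h1 : 0 < ‖z - eN N‖ := norm_pos_iff.2 (sub_ne_zero.2 hmem.2)
    have h2 : 0 < ‖z + eN N‖ := h1.trans ((mem_halfSpace_iff z).1 hmem.1)
    rw [greenHalf, Set.indicator_of_mem hmem, hnewton, hnewton, sub_neg_eq_add] at hz'
    have h5 : 0 < ‖z - eN N‖ ^ m := by positivity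
    have h6 : 0 < ‖z + eN N‖ ^ m := by positivity
    change ‖z - eN N‖ ^ m * (1 + c * ‖z + eN N‖ ^ m) ≤ ‖z + eN N‖ ^ m
    have h7 := mul_le_mul_of_nonneg_left hz' (mul_pos h5 h6).le
    have h8 : ‖z - eN N‖ ^ m * ‖z + eN N‖ ^ m * ((‖z - eN N‖ ^ m)⁻¹ - (‖z + eN N‖ ^ m)⁻¹) =
      ‖z + eN N‖ ^ m - ‖z - eN N‖ ^ m := by field_simp
    rw [h8] at h7
    linarith

/-- Method of images: the reflected pole lies outside the half-space, so its Dirac mass is invisible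
to functions supported inside. The constant is that of the whole space, which allows the two
settings to be compared. -/
lemma isGreen_halfSpace (hN : 2 < N) :
    IsGreen (halfSpace N) (eN N) (greenHalf N) (((N : ℝ) - 2) * sphereArea N) where
  isOpen := isOpen_halfSpace
  mem := eN_mem_halfSpace
  const_pos := (isGreen_univ hN).const_pos
  zero_off := fun z hz => Set.indicator_of_notMem (fun h => hz h.1) _
  zero_pole := Set.indicator_of_notMem (fun h => h.2 rfl) _
  pos := fun z hz => by
    have hN' : (2:ℝ) < N := by exact_mod_cast hN
    rw [greenHalf, Set.indicator_of_mem hz, sub_pos, newton, newton, sub_neg_eq_add]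
    exact Real.rpow_lt_rpow_of_neg (norm_pos_iff.2 (sub_ne_zero.2 hz.2))
      ((mem_halfSpace_iff z).1 hz.1) (by linarith)
  smooth := fun z hz =>
    ((contDiffAt_newton hz.2).sub (contDiffAt_newton (ne_neg_eN hz.1))).congr_of_eventuallyEq
      (greenHalf_eventuallyEq hz)
  compact := fun c hc => exists_isCompact_greenHalf hN hc
  pole := by
    have h1 : Tendsto (fun z => newton N (eN N) z - newton N (-eN N) z) (𝓝[≠] eN N) atTop := by
      simp_rw [sub_eq_add_neg]
      refine (tendsto_newton hN).atTop_add (C := - newton N (-eN N) (eN N)) ?_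
      exact ((contDiffAt_newton (ne_neg_eN eN_mem_halfSpace)).continuousAt.neg).tendsto.mono_left
        nhdsWithin_le_nhds
    refine h1.congr' ?_
    filter_upwards [self_mem_nhdsWithin, mem_nhdsWithin_of_mem_nhds
      (isOpen_halfSpace.mem_nhds eN_mem_halfSpace)] with z hz1 hz2
    have hz : z ∈ halfSpace N \ {eN N} := ⟨hz2, hz1⟩
    rw [greenHalf, Set.indicator_of_mem hz]
  gradient_ne := fun z hz => gradient_greenHalf_ne hN hz
  green := fun ψ h1 h2 h3 h4 => by
    have h5 : -eN N ∉ tsupport ψ := fun h => neg_eN_notMem_halfSpace (h3 h)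
    have h6 : ψ (-eN N) = 0 := image_eq_zero_of_notMem_tsupport h5
    have h7 : ∀ᶠ z in 𝓝 (-eN N), ψ z = ψ (-eN N) := by
      rw [h6]; exact notMem_tsupport_iff_eventuallyEq.1 h5
    have hN0 : 0 < N := by omega
    have h8 : ∀ z ∈ halfSpace N \ {eN N}, inner ℝ (gradient ψ z) (gradient (greenHalf N) z) =
        inner ℝ (gradient ψ z) (gradient (newton N (eN N)) z) -
          inner ℝ (gradient ψ z) (gradient (newton N (-eN N)) z) := by
      intro z hz
      rw [gradient_greenHalf hz, inner_sub_right]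
    rw [← IsGreen.restrict_sdiff_singleton (Ω := halfSpace N) (e := eN N) hN0,
      setIntegral_congr_fun (isOpen_halfSpace.sdiff isClosed_singleton).measurableSet h8,
      IsGreen.restrict_sdiff_singleton hN0, setIntegral_eq_integral_of_forall_compl_eq_zero,
      integral_sub (integrable_inner_gradient_newton h1 h2 h4)
        (integrable_inner_gradient_newton h1 h2 h7),
      integral_inner_gradient_newton_eq hN0 h1 h2 h4,
      integral_inner_gradient_newton_eq hN0 h1 h2 h7, h6, mul_zero, sub_zero]
    intro z hz
    have : gradient ψ z = 0 :=
      image_eq_zero_of_notMem_tsupport fun h => hz (h3 (tsupport_gradient_subset ψ h))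
    simp [this]

end halfSpace

/-! ### Exponents, and the radial Hardy–Sobolev inequality in one variable. -/

section exponents

variable {N : ℕ} {s : ℝ}

lemma two_lt_critExp (hN : 2 < N) (hs : s < 2) : 2 < critExp N s := by
  have hN' : (2:ℝ) < N := by exact_mod_cast hN
  rw [critExp, lt_div_iff₀ (by linarith)]
  linarith

lemma mul_critExp (hN : 2 < N) :
    ((N : ℝ) - 2) * (critExp N s / 2 + 1) = 2 * ((N : ℝ) - 1) - s := by
  have hN' : (2:ℝ) < N := by exact_mod_cast hN
  have : (N : ℝ) - 2 ≠ 0 := by linarith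
  rw [critExp]
  field_simp
  ring

end exponents

section radial

variable {N : ℕ} {s : ℝ} {w : ℝ → ℝ}

lemma isTest_comp_newton (hN : 2 < N) (hw : IsProfile w) :
    IsTest Set.univ (w ∘ newton N 0) := by
  obtain ⟨c1, a, ha, b, -, h0, h1⟩ := hw
  have h := (isGreen_univ hN).comp_props ha h0 h1 (n := ⊤) c1
  exact ⟨h.1, h.2.1, Set.subset_univ _⟩

lemma integral_gradient_comp_newton (hN : 2 < N) (hw : IsProfile w) :
    ∫ z, ‖gradient (w ∘ newton N 0) z‖ ^ 2 =
      ((N : ℝ) - 2) * sphereArea N * ∫ t in Set.Ioi (0:ℝ), deriv w t ^ 2 := by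
  have hG := isGreen_univ hN
  have hN0 : 0 < N := by omega
  have hw0 : w 0 = 0 := by
    obtain ⟨-, a, ha, -, -, h0, -⟩ := hw
    exact h0 0 ha.le
  rw [← hG.integral_comp hN0 (F := fun t => deriv w t ^ 2)
    (hw.continuous_deriv.pow 2).aestronglyMeasurable, hG.integral_energy,
    ← setIntegral_univ, ← IsGreen.restrict_sdiff_singleton (Ω := Set.univ) (e := 0) hN0]
  refine setIntegral_congr_fun hG.isOpen_diff.measurableSet fun z hz => ?_
  have h := hG.gradient_update (C := 0) hz (hw.hasDerivAt (newton N 0 z))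
  rw [hG.update_zero hw0] at h
  simp only [h, norm_smul, mul_pow, Real.norm_eq_abs, sq_abs]
  ring

/-- For the Newton kernel `|∇Γ|² Γ^(-(p/2+1)) = (N-2)² |z|^(-2(N-1)) |z|^(2(N-1)-s) = (N-2)²
|z|^(-s)`. -/
lemma integral_weight_comp_newton (hN : 2 < N) (hs : s < 2) (hw : IsProfile w) :
    ∫ z, |(w ∘ newton N 0) z| ^ critExp N s / ‖z‖ ^ s =
      ((N : ℝ) - 2) * sphereArea N * ∫ t in Set.Ioi (0:ℝ),
        (((N : ℝ) - 2) ^ 2)⁻¹ * (|w t| ^ critExp N s * t ^ (-(critExp N s / 2 + 1))) := by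
  have hG := isGreen_univ hN
  have hN0 : 0 < N := by omega
  have hN' : (2:ℝ) < N := by exact_mod_cast hN
  have hp := two_lt_critExp hN hs
  rw [← hG.integral_comp hN0 (F := fun t =>
    (((N : ℝ) - 2) ^ 2)⁻¹ * (|w t| ^ critExp N s * t ^ (-(critExp N s / 2 + 1))))
    ((hw.integrableOn_weight (by linarith) _).const_mul _).aestronglyMeasurable,
    hG.integral_energy,
    ← setIntegral_univ, ← IsGreen.restrict_sdiff_singleton (Ω := Set.univ) (e := 0) hN0]
  refine setIntegral_congr_fun hG.isOpen_diff.measurableSet fun z hz => ?_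
  have hz0 : z ≠ 0 := hz.2
  have h0 : 0 < ‖z‖ := norm_pos_iff.2 hz0
  have e1 : newton N 0 z ^ (-(critExp N s / 2 + 1)) = ‖z‖ ^ (2 * ((N : ℝ) - 1) - s) := by
    rw [newton, sub_zero, ← Real.rpow_mul h0.le, neg_mul_neg, mul_critExp hN]
  have e2 : ‖z‖ ^ (-2 * ((N : ℝ) - 1)) * ‖z‖ ^ (2 * ((N : ℝ) - 1) - s) = (‖z‖ ^ s)⁻¹ := by
    rw [← Real.rpow_add h0, ← Real.rpow_neg h0.le]
    congr 1; ring
  have h2 : ((N : ℝ) - 2) ^ 2 ≠ 0 := pow_ne_zero _ (by linarith)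
  simp only [Function.comp_apply]
  rw [norm_gradient_newton_sq hz0, e1, sub_zero, div_eq_mul_inv, ← e2]
  linear_combination (-(|w (newton N 0 z)| ^ critExp N s) * ‖z‖ ^ (-2 * ((N : ℝ) - 1)) *
    ‖z‖ ^ (2 * ((N : ℝ) - 1) - s)) * mul_inv_cancel₀ h2

lemma hardySobolevConst_nonneg : 0 ≤ hardySobolevConst N s := by
  refine Real.sInf_nonneg ?_
  rintro c ⟨φ, -, -, rfl⟩
  refine div_nonneg (integral_nonneg fun z => sq_nonneg _)
    (Real.rpow_nonneg (integral_nonneg fun z => ?_) _)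
  positivity

lemma hardySobolevConst_le {φ : E N → ℝ} (h : IsTest Set.univ φ) (h0 : φ ≠ 0) :
    hardySobolevConst N s ≤ (∫ z, ‖gradient φ z‖ ^ 2) /
      (∫ z, |φ z| ^ critExp N s / ‖z‖ ^ s) ^ (2 / critExp N s) := by
  refine csInf_le ⟨0, ?_⟩ ⟨φ, h, h0, rfl⟩
  rintro c ⟨φ, -, -, rfl⟩
  refine div_nonneg (integral_nonneg fun z => sq_nonneg _)
    (Real.rpow_nonneg (integral_nonneg fun z => ?_) _)
  positivity

/-- The Hardy–Sobolev inequality for radial functions, in the variable `t = |z|^{2-N}`. -/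
lemma profile_hardySobolev (hN : 2 < N) (hs : s < 2) (hS : 0 < hardySobolevConst N s)
    (hw : IsProfile w) :
    ∫ t in Set.Ioi (0:ℝ), |w t| ^ critExp N s * t ^ (-(critExp N s / 2 + 1)) ≤
      ((((N : ℝ) - 2) * sphereArea N / hardySobolevConst N s) ^ (critExp N s / 2) /
        (((N : ℝ) - 2) * sphereArea N * (((N : ℝ) - 2) ^ 2)⁻¹)) *
        (∫ t in Set.Ioi (0:ℝ), deriv w t ^ 2) ^ (critExp N s / 2) := by
  set p := critExp N s
  have hp : 2 < p := two_lt_critExp hN hs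
  have hN' : (2:ℝ) < N := by exact_mod_cast hN
  have hκ : 0 < ((N : ℝ) - 2) * sphereArea N := (isGreen_univ hN).const_pos
  have hw2 := integral_weight_comp_newton hN hs hw
  have hwg := integral_gradient_comp_newton hN hw
  rw [integral_const_mul, ← mul_assoc] at hw2
  set κ := ((N : ℝ) - 2) * sphereArea N
  set c := κ * (((N : ℝ) - 2) ^ 2)⁻¹ with hc
  have hcpos : 0 < c := mul_pos hκ (inv_pos.2 (pow_pos (by linarith) 2))
  set I := ∫ t in Set.Ioi (0:ℝ), |w t| ^ p * t ^ (-(p / 2 + 1))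
  set F := ∫ t in Set.Ioi (0:ℝ), deriv w t ^ 2
  have hF : 0 ≤ F := integral_nonneg fun t => sq_nonneg _
  have hI : 0 ≤ I := by
    refine setIntegral_nonneg measurableSet_Ioi fun t ht => ?_
    have : 0 < t := ht
    positivity
  -- A nonzero competitor is needed in the infimum; if the weighted integral vanishes there is
  -- nothing to prove.
  rcases hI.eq_or_lt with h0 | hIpos
  · rw [← h0]; positivity
  have hne : w ∘ newton N 0 ≠ 0 := by
    intro h
    rw [h] at hw2
    have hp0 : critExp N s ≠ 0 := by change p ≠ 0; linarith
    simp only [Pi.zero_apply, abs_zero, Real.zero_rpow hp0, zero_div, integral_zero] at hw2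
    exact (mul_pos hcpos hIpos).ne hw2
  have h1 := hardySobolevConst_le (s := s) (isTest_comp_newton hN hw) hne
  rw [hwg, hw2, le_div_iff₀ (Real.rpow_pos_of_pos (mul_pos hcpos hIpos) _), mul_comm,
    ← le_div_iff₀ hS] at h1
  have h2 := Real.rpow_le_rpow (by positivity) h1 (show 0 ≤ p / 2 by linarith)
  rw [← Real.rpow_mul (mul_pos hcpos hIpos).le, show 2 / critExp N s * (p / 2) = 1 by
    change 2 / p * (p / 2) = 1; field_simp, Real.rpow_one, mul_div_right_comm,
    Real.mul_rpow (by positivity) hF] at h2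
  rw [div_mul_eq_mul_div, le_div_iff₀ hcpos]
  linarith

end radial

/-! ### The weight of the theorem in terms of the Green function. -/

section halfSpace

variable {N : ℕ} [NeZero N] {s : ℝ}

lemma norm_gradient_greenHalf_sq {z : E N} (hz : z ∈ halfSpace N \ {eN N}) :
    ‖gradient (greenHalf N) z‖ ^ 2 = ((N : ℝ) - 2) ^ 2 *
      (‖z - eN N‖ ^ (-2 * ((N : ℝ) - 1)) + ‖z + eN N‖ ^ (-2 * ((N : ℝ) - 1)) -
        2 * (‖z - eN N‖ ^ N)⁻¹ * (‖z + eN N‖ ^ N)⁻¹ * (‖z‖ ^ 2 - 1)) := by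
  have hb := ne_neg_eN hz.1
  rw [gradient_greenHalf hz, norm_sub_sq_real, norm_gradient_newton_sq hz.2,
    norm_gradient_newton_sq hb, gradient_newton hz.2, gradient_newton hb, sub_neg_eq_add]
  have h1 : inner ℝ (z - eN N) (z + eN N) = ‖z‖ ^ 2 - 1 := by
    rw [inner_sub_left, inner_add_right, inner_add_right, real_inner_self_eq_norm_sq,
      real_inner_self_eq_norm_sq, norm_eN, real_inner_comm]
    ring
  simp only [inner_smul_left, inner_smul_right, conj_trivial, h1]
  ring

/-- The weight in the inequality is the pull-back of the radial Hardy–Sobolev weight. -/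
lemma hsIntegrand_eq (hN : 2 < N) (u : E N → ℝ) {z : E N} (hz : z ∈ halfSpace N \ {eN N}) :
    hsIntegrand N s u z = ‖gradient (greenHalf N) z‖ ^ 2 *
      ((((N : ℝ) - 2) ^ 2)⁻¹ *
        (|u z| ^ critExp N s * greenHalf N z ^ (-(critExp N s / 2 + 1)))) := by
  have hN' : (2:ℝ) < N := by exact_mod_cast hN
  have ha : 0 < ‖z - eN N‖ := norm_pos_iff.2 (sub_ne_zero.2 hz.2)
  have hab := (mem_halfSpace_iff z).1 hz.1
  have hb : 0 < ‖z + eN N‖ := ha.trans hab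
  rw [norm_gradient_greenHalf_sq hz, hsIntegrand, V2, X, greenHalf, Set.indicator_of_mem hz,
    newton, newton, sub_neg_eq_add]
  set a := ‖z - eN N‖
  set b := ‖z + eN N‖
  set m := (N:ℝ) - 2 with hm
  have hm0 : 0 < m := by rw [hm]; linarith
  have hX : (a ^ 2 / b ^ 2) ^ (m / 2) = a ^ m * b ^ (-m) := by
    rw [← div_pow, ← Real.rpow_natCast, ← Real.rpow_mul (by positivity),
      show ((2:ℕ):ℝ) * (m / 2) = m by push_cast; ring, Real.div_rpow ha.le hb.le,
      Real.rpow_neg hb.le, div_eq_mul_inv]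
  have hX1 : (a ^ 2 / b ^ 2) ^ ((N:ℝ) - 1) = a ^ (2 * ((N:ℝ) - 1)) * b ^ (-2 * ((N:ℝ) - 1)) := by
    rw [← div_pow, ← Real.rpow_natCast, ← Real.rpow_mul (by positivity),
      Real.div_rpow ha.le hb.le, neg_mul, Real.rpow_neg hb.le, div_eq_mul_inv]
    push_cast; rfl
  rw [hX, hX1]
  -- `Y` is `X^((N-2)/2)`, and `Γ = a^(-m) (1 - Y)`. Since `p/2 + 1 = 2 + (2-s)/m`, the power of `Γ`
  -- produces both the square in the denominator of `V2` and the extra factor of the weight.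
  set Y := a ^ m * b ^ (-m) with hY
  have hY1 : 0 < 1 - Y := by
    have : b ^ (-m) < a ^ (-m) := Real.rpow_lt_rpow_of_neg ha hab (by linarith)
    have h2 : Y < a ^ m * a ^ (-m) := mul_lt_mul_of_pos_left this (by positivity)
    rw [← Real.rpow_add ha, add_neg_cancel, Real.rpow_zero] at h2
    linarith
  have hG : a ^ (-m) - b ^ (-m) = a ^ (-m) * (1 - Y) := by
    rw [hY, mul_sub, mul_one, ← mul_assoc, ← Real.rpow_add ha, neg_add_cancel, Real.rpow_zero,
      one_mul]
  have hG1 : (a ^ (-m) - b ^ (-m)) ^ (-(critExp N s / 2 + 1)) =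
      a ^ (2 * ((N:ℝ) - 1)) * (a ^ s)⁻¹ * ((1 - Y) ^ 2 * (1 - Y) ^ ((2 - s) / m))⁻¹ := by
    rw [hG, Real.mul_rpow (by positivity) hY1.le, ← Real.rpow_mul ha.le, neg_mul_neg,
      mul_critExp hN, Real.rpow_sub ha, div_eq_mul_inv, Real.rpow_neg hY1.le,
      ← Real.rpow_natCast (1 - Y) 2, ← Real.rpow_add hY1]
    congr 3
    rw [critExp, ← hm]
    field_simp
    rw [hm]; push_cast; ring
  have hA : a ^ (-2 * ((N:ℝ) - 1)) * a ^ (2 * ((N:ℝ) - 1)) = 1 := by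
    rw [← Real.rpow_add ha, neg_mul, neg_add_cancel, Real.rpow_zero]
  have hB : (a ^ N)⁻¹ * (b ^ N)⁻¹ * a ^ (2 * ((N:ℝ) - 1)) = Y / b ^ 2 := by
    rw [hY, ← Real.rpow_natCast a, ← Real.rpow_natCast b, ← Real.rpow_natCast b 2,
      ← Real.rpow_neg ha.le, ← Real.rpow_neg hb.le, div_eq_mul_inv, ← Real.rpow_neg hb.le,
      mul_assoc (a ^ m), ← Real.rpow_add hb, mul_right_comm, ← Real.rpow_add ha, hm]
    congr 2 <;> push_cast <;> ring
  rw [hG1]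
  set A := a ^ (2 * ((N:ℝ) - 1))
  set A' := a ^ (-2 * ((N:ℝ) - 1))
  set B := b ^ (-2 * ((N:ℝ) - 1))
  set D := (1 - Y) ^ 2 * (1 - Y) ^ ((2 - s) / m) with hD
  -- The numerator of `V2` is the bracket in `|∇Γ|²` multiplied by `a^(2(N-1))`.
  have hnum : (A' + B - 2 * (a ^ N)⁻¹ * (b ^ N)⁻¹ * (‖z‖ ^ 2 - 1)) * A =
      1 + A * B - 2 * Y * (‖z‖ ^ 2 - 1) / b ^ 2 := by
    linear_combination hA - 2 * (‖z‖ ^ 2 - 1) * hB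
  have hm2 : m ^ 2 * (m ^ 2)⁻¹ = 1 := mul_inv_cancel₀ (by positivity)
  rw [← hnum, div_div, ← hD]
  simp only [div_eq_mul_inv]
  linear_combination (-(|u z| ^ critExp N s) * (a ^ s)⁻¹ *
    (A' + B - 2 * (a ^ N)⁻¹ * (b ^ N)⁻¹ * (‖z‖ ^ 2 - 1)) * A * D⁻¹) * hm2

lemma green_eq_greenHalf {z : E N} (hz : z ∈ halfSpace N \ {eN N}) :
    green N z = 1 / (((N : ℝ) - 2) * sphereArea N) * greenHalf N z := by
  rw [green, greenHalf, Set.indicator_of_mem hz, newton, newton, sub_neg_eq_add]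

end halfSpace

end HalfSpaceHS

/-! ### The inequality on the half-space. -/

theorem theorem4p5 (N : ℕ) [NeZero N] (hN : 2 < N) (s : ℝ) (hs0 : 0 ≤ s) (hs2 : s < 2)
    (u : HalfSpaceHS.E N → ℝ) (g : HalfSpaceHS.E N → HalfSpaceHS.E N)
    (hu : HalfSpaceHS.MemHomSobolevZero 2 (HalfSpaceHS.halfSpace N) u)
    (hg : HalfSpaceHS.IsWeakGradient (HalfSpaceHS.halfSpace N) u g)
    (hsymm : ∃ v : ℝ → ℝ, ∀ᵐ z ∂(volume.restrict (HalfSpaceHS.halfSpace N)),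
      u z = v (HalfSpaceHS.green N z)) :
    IntegrableOn (HalfSpaceHS.hsIntegrand N s u) (HalfSpaceHS.halfSpace N) volume ∧
    HalfSpaceHS.hardySobolevConst N s *
        (∫ z in HalfSpaceHS.halfSpace N, HalfSpaceHS.hsIntegrand N s u z)
          ^ (2 / HalfSpaceHS.critExp N s)
      ≤ ∫ z in HalfSpaceHS.halfSpace N, ‖g z‖ ^ 2 := by
  open HalfSpaceHS in
  obtain ⟨v, hv⟩ := hsymm
  have hN0 : 0 < N := by omega
  have hN' : (2:ℝ) < N := by exact_mod_cast hN
  have hG := isGreen_halfSpace hN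
  set p := critExp N s with hp_def
  have hp : 2 < p := two_lt_critExp hN hs2
  set κ := ((N : ℝ) - 2) * sphereArea N with hκ_def
  have hκ : 0 < κ := hG.const_pos
  set c := (((N : ℝ) - 2) ^ 2)⁻¹ with hc
  have hcpos : 0 < c := inv_pos.2 (pow_pos (by linarith) 2)
  have hU : MeasurableSet (halfSpace N \ {eN N}) := hG.isOpen_diff.measurableSet
  have hres := IsGreen.restrict_sdiff_singleton (Ω := halfSpace N) (e := eN N) hN0
  -- The normalising factor `1/κ` of the Green function is absorbed into the profile.
  have hv' : ∀ᵐ z ∂(volume.restrict (halfSpace N)), u z = v (1 / κ * greenHalf N z) := by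
    rw [← hres] at hv ⊢
    filter_upwards [hv, ae_restrict_mem hU] with z h1 h2
    rw [h1, green_eq_greenHalf h2]
  obtain ⟨f, hf, hfle, hfu⟩ := hG.exists_profile hN0 hu hg (v := fun t => v (1 / κ * t)) hv'
  set W : ℝ → ℝ := fun t => ∫ r in (0:ℝ)..t, f r with hW
  set J : ℝ → ℝ := fun t => |W t| ^ p * t ^ (-(p / 2 + 1)) with hJ
  set F := ∫ t in Set.Ioi (0:ℝ), f t ^ 2
  have hF : 0 ≤ F := integral_nonneg fun t => sq_nonneg _
  have hJ0 : ∀ t ∈ Set.Ioi (0:ℝ), 0 ≤ J t := fun t ht => by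
    have : 0 < t := ht
    simp only [hJ]; positivity
  have hJm : AEStronglyMeasurable J (volume.restrict (Set.Ioi (0:ℝ))) := by
    refine ContinuousOn.aestronglyMeasurable ?_ measurableSet_Ioi
    refine ContinuousOn.mul ((continuousOn_prim hf).abs.rpow_const fun t _ => Or.inr (by linarith))
      (continuousOn_id.rpow_const fun t ht => Or.inl (ne_of_gt ht))
  have hJae : 0 ≤ᵐ[volume.restrict (Set.Ioi (0:ℝ))] J := by
    filter_upwards [ae_restrict_mem measurableSet_Ioi] with t ht using hJ0 t ht
  have hJi : IntegrableOn J (Set.Ioi 0) := by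
    rw [IntegrableOn, ← lintegral_ofReal_ne_top_iff_integrable hJm hJae]
    refine ne_top_of_le_ne_top ENNReal.ofReal_ne_top
      (lintegral_weight_le_of_profile (by linarith) (fun w hw => hw.weighted_le hp) hf)
  have hcJ : AEStronglyMeasurable (fun t => c * J t) (volume.restrict (Set.Ioi (0:ℝ))) :=
    hJm.const_mul c
  have hae : ∀ᵐ z ∂(volume.restrict (halfSpace N \ {eN N})),
      ‖gradient (greenHalf N) z‖ ^ 2 * (c * J (greenHalf N z)) = hsIntegrand N s u z := by
    rw [← hres] at hfu
    filter_upwards [hfu, ae_restrict_mem hU] with z h1 h2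
    rw [hsIntegrand_eq hN u h2, h1]
  have hint : ∫ z in halfSpace N, hsIntegrand N s u z = κ * (c * ∫ t in Set.Ioi (0:ℝ), J t) := by
    rw [← hres, ← integral_congr_ae hae, ← integral_const_mul, ← hG.integral_comp hN0 hcJ,
      hG.integral_energy]
  refine ⟨?_, ?_⟩
  · have h1 := (hG.integrable_energy_iff _).1 ((hG.integrable_comp hN0 hcJ).2 (hJi.const_mul c))
    rw [IntegrableOn, ← hres]
    exact h1.congr hae
  rw [hint]
  have hI0 : 0 ≤ ∫ t in Set.Ioi (0:ℝ), J t := setIntegral_nonneg measurableSet_Ioi hJ0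
  -- If the best constant were `0` the inequality would be trivial; otherwise division by it is
  -- allowed.
  rcases (hardySobolevConst_nonneg (N := N) (s := s)).eq_or_lt with hS | hS
  · rw [← hS, zero_mul]
    exact integral_nonneg fun z => sq_nonneg _
  refine le_trans ?_ hfle
  -- The sharp radial inequality, extended to the primitive of `f`; raising it to the power `2/p`
  -- gives the claim, with `κ ∫ f²` bounded by the energy of `u`.
  have h1 := lintegral_weight_le_of_profile (by linarith)
    (fun w hw => profile_hardySobolev hN hs2 hS hw) hf
  rw [← ofReal_integral_eq_lintegral_ofReal hJi hJae, ENNReal.ofReal_le_ofReal_iff (by positivity),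
    div_mul_eq_mul_div, le_div_iff₀ (mul_pos hκ hcpos)] at h1
  have h2 : κ * (c * ∫ t in Set.Ioi (0:ℝ), J t) ≤
      (κ * F / hardySobolevConst N s) ^ (p / 2) := by
    rw [mul_div_right_comm, Real.mul_rpow (by positivity) hF]
    linarith
  have h3 := Real.rpow_le_rpow (by positivity) h2 (show 0 ≤ 2 / p by positivity)
  rw [← Real.rpow_mul (by positivity), show p / 2 * (2 / p) = 1 by field_simp, Real.rpow_one,
    le_div_iff₀ hS] at h3
  linarith
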